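/- Let $p(x,y,z)=x^2+y^2-2z^2$. For integers $0\le m\le l$ let $P_l(x)=\frac{1}{2^l\,l!}\frac{d^l}{dx^l}(x^2-1)^l$ be the Legendre polynomial and $P_l^m(x)=(-1)^m(1-x^2)^{m/2}\frac{d^m}{dx^m}P_l(x)$, $x\in[-1,1]$, the associated Legendre function. Write $P_2\mid P_l^m$ if the polynomial $P_2$ divides the polynomial $P_l^m$ (for $m$ even), respectively the polynomial $P_l^m/\sqrt{1-x^2}$ (for $m$ odd). (i) For every integer $l\ge 0$ the following are equivalent: (1) there is a nonzero real harmonic polynomial $h_l$ on $\mathbb{R}^3$ of degree $l$ (not necessarily homogeneous) such that $p\mid h_l$; (2) there is an integer $m$ with $0\le m\le l$ such that $P_2\mid P_l^m$. (ii) Let $B_1\subset\mathbb{R}^3$ be the open unit ball, $Z=\{p=0\}\cap B_1$, and let $\mathcal{H}(Z)$ be the real vector space of all harmonic functions $u:B_1\to\mathbb{R}$ with $u|_Z=0$. Then $\mathcal{H}(Z)$ is finite dimensional if and only if there are only finitely many pairs $(l,m)$ of integers with $0\le m\le l$ and $P_2\mid P_l^m$. -/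

import Mathlib

noncomputable section

namespace HarmonicCone

/-- Euclidean three-space; the coordinates `0, 1, 2` are `x, y, z`. -/
abbrev Space : Type := EuclideanSpace ℝ (Fin 3)

/-- The quadratic polynomial `x² + y² - 2z²`. -/
def conePoly : MvPolynomial (Fin 3) ℝ :=
  MvPolynomial.X 0 ^ 2 + MvPolynomial.X 1 ^ 2 - 2 * MvPolynomial.X 2 ^ 2

/-- The function on three-space given by a real polynomial in three variables. -/
def polyFun (h : MvPolynomial (Fin 3) ℝ) : Space → ℝ :=
  fun v => MvPolynomial.eval (fun i => v i) h

/-- A polynomial is harmonic if the function that it defines on three-space is harmonic. -/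
def IsHarmonicPoly (h : MvPolynomial (Fin 3) ℝ) : Prop :=
  InnerProductSpace.HarmonicOnNhd (polyFun h) Set.univ

/-- The Legendre polynomial `P_l`, by Rodrigues' formula. -/
def legendre (l : ℕ) : Polynomial ℝ :=
  Polynomial.C (1 / ((2 : ℝ) ^ l * (l.factorial : ℝ))) *
    Polynomial.derivative^[l] ((Polynomial.X ^ 2 - 1) ^ l)

/-- The associated Legendre function
`P_l^m(x) = (-1)^m (1 - x²)^(m/2) (d/dx)^m P_l(x)`, to be used for `x ∈ [-1, 1]`. -/
def assocLegendre (l m : ℕ) (x : ℝ) : ℝ :=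
  (-1) ^ m * √(1 - x ^ 2) ^ m * (Polynomial.derivative^[m] (legendre l)).eval x

/-- `P₂ ∣ P_l^m`: the polynomial `P₂` divides the polynomial `P_l^m` if `m` is even, and the
polynomial `P_l^m / √(1 - x²)` if `m` is odd. -/
def LegendreTwoDvd (l m : ℕ) : Prop :=
  ∃ Q : Polynomial ℝ,
    (∀ x ∈ Set.Icc (-1 : ℝ) 1, assocLegendre l m x = √(1 - x ^ 2) ^ (m % 2) * Q.eval x) ∧
    legendre 2 ∣ Q

/-- The open unit ball of three-space. -/
abbrev unitBall : Set Space := Metric.ball 0 1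

/-- The space `H(Z)` of the real functions on the open unit ball that are harmonic there and
vanish on the part of the cone `x² + y² - 2z² = 0` inside the ball. (Being harmonic on the open
ball does not depend on the values outside it, so any extension `U` may be used to express it.) -/
def harmonicVanishing : Submodule ℝ (unitBall → ℝ) where
  carrier := {u | (∃ U : Space → ℝ, (∀ v : unitBall, U v = u v) ∧
      InnerProductSpace.HarmonicOnNhd U unitBall) ∧
    ∀ v : unitBall, polyFun conePoly v = 0 → u v = 0}
  zero_mem' := ⟨⟨fun _ => 0, fun _ => rfl, InnerProductSpace.harmonicOnNhd_const 0⟩,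
    fun _ _ => rfl⟩
  add_mem' := by
    rintro u w ⟨⟨U, hU, hU'⟩, hu⟩ ⟨⟨W, hW, hW'⟩, hw⟩
    refine ⟨⟨U + W, fun v => ?_, hU'.add hW'⟩, fun v hv => ?_⟩
    · simp [hU, hW]
    · simp [hu v hv, hw v hv]
  smul_mem' := by
    rintro c u ⟨⟨U, hU, hU'⟩, hu⟩
    refine ⟨⟨c • U, fun v => ?_, hU'.const_smul⟩, fun v hv => ?_⟩
    · simp [hU]
    · simp [hu v hv]

end HarmonicCone

end

/-! Everything reduces to one number. The solid harmonic of degree m + j and order m used here is Re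
(x + iy)^m times Σ c_k (x² + y²)^k z^(j - 2k), and the same c_k expand the m-th derivative of
P_(m+j) in the products (1 - r²)^k r^(j - 2k). On the cone x² + y² = 2z², and at the roots ±1/√3 of
P₂ likewise 1 - r² = 2r², so both sums collapse to a multiple of `coneValue m j` = Σ c_k 2^k. Hence
P₂ ∣ P_(m+j)^m exactly when this number is zero (`legendreTwoDvd_iff`), and then p divides the solid
harmonic (`conePoly_dvd_solidHarmonic`).

Conversely (`exists_coneValue_eq_zero`), take a nonzero homogeneous harmonic h that vanishes on the
cone, and sort its monomials in w = x + iy, w' = x - iy, z by the difference of the exponents of w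
and w'. These are the Fourier modes for rotation about the z-axis. On the circle where the cone
meets z = 1 each mode vanishes separately, while Laplace's equation makes the coefficients of a mode
proportional to the c_k. So a nonzero mode forces some `coneValue` of that degree to vanish. Only
vanishing on the cone is used, so no Nullstellensatz for p is needed.

For (i) this applies to the leading homogeneous component, which is again harmonic and, since the
cone is a union of lines through the origin, again vanishes on it. For (ii), infinitely many pairs
give solid harmonics of unbounded degree in H(Z). If the pairs are finite in number, all Taylor
terms of high degree of a function in H(Z) are zero, because each term is a homogeneous harmonic
polynomial vanishing on the cone; the function is then a polynomial of bounded degree. This needs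
analyticity of harmonic functions (`analyticAt_of_harmonicAt`): a cut-off harmonic function is a
constant times the Newtonian potential of its Laplacian, and that potential is analytic off the
support of its density. -/

/-! ### Derivatives of Legendre polynomials and their values at 1/√3 -/

namespace HarmonicCone

/-- The coefficient of `(1 - x²)^k x^(j - 2k)` in the `m`-th derivative of `P_(m + j)`, up to a
normalization that does not depend on `k`. -/
noncomputable def solidCoeff (m j k : ℕ) : ℝ :=
  (-1) ^ k * 2 ^ (j - 2 * k) / (k.factorial * (m + k).factorial * (j - 2 * k).factorial)

/-- The value of the `m`-th derivative of `P_(m + j)` at `1 / √3`, up to normalization. -/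
noncomputable def coneValue (m j : ℕ) : ℝ :=
  ∑ k ∈ Finset.range (j / 2 + 1), solidCoeff m j k * 2 ^ k

lemma solidCoeff_zero_ne_zero (m j : ℕ) : solidCoeff m j 0 ≠ 0 := by
  simp only [solidCoeff, pow_zero, mul_zero, Nat.sub_zero]
  positivity

/-- This recurrence is Laplace's equation for the solid harmonic, read off coefficient by
coefficient. -/
lemma solidCoeff_succ (m j k : ℕ) (h : 2 * (k + 1) ≤ j) :
    4 * ((k : ℝ) + 1) * (m + k + 1) * solidCoeff m j (k + 1) =
      -((j - 2 * k : ℕ) * (j - 2 * k - 1 : ℕ) * solidCoeff m j k) := by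
  obtain ⟨i, rfl⟩ := Nat.exists_eq_add_of_le h
  have h1 : 2 * (k + 1) + i - 2 * (k + 1) = i := by omega
  have h2 : 2 * (k + 1) + i - 2 * k = i + 2 := by omega
  simp only [solidCoeff, h1, h2, show i + 2 - 1 = i + 1 by omega]
  rw [Nat.factorial_succ k, ← add_assoc m k 1, Nat.factorial_succ (m + k),
    Nat.factorial_succ (i + 1), Nat.factorial_succ i]
  push_cast
  field_simp
  ring

-- The Hasse derivative at r is a Taylor coefficient, and (X + r)² - 1 = -(1 - r²) + (X + 2r) X. The
-- binomial theorem applied to this splitting produces the powers of 1 - r²; terms with 2k > j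
-- contribute nothing.
open Polynomial in
lemma hasseDeriv_eval_sq_sub_one_pow (m j : ℕ) (r : ℝ) :
    (hasseDeriv (m + j + m) ((X ^ 2 - 1 : ℝ[X]) ^ (m + j))).eval r =
      (m + j).factorial *
        ∑ k ∈ Finset.range (j / 2 + 1), solidCoeff m j k * ((1 - r ^ 2) ^ k * r ^ (j - 2 * k)) := by
  rw [← taylor_coeff]
  have e : taylor r ((X ^ 2 - 1 : ℝ[X]) ^ (m + j)) =
      ∑ k ∈ Finset.range (m + j + 1),
        C ((-(1 - r ^ 2)) ^ k * ((m + j).choose k : ℝ)) *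
          ((X + C (2 * r)) ^ (m + j - k) * X ^ (m + j - k)) := by
    have : taylor r (X ^ 2 - 1 : ℝ[X]) = C (-(1 - r ^ 2)) + (X + C (2 * r)) * X := by
      rw [map_sub, taylor_X_pow, taylor_one]
      simp only [map_neg, map_sub, map_mul, map_pow, C_1, map_ofNat]
      ring
    rw [taylor_pow, this, add_pow]
    refine Finset.sum_congr rfl fun k _ => ?_
    simp only [mul_pow, map_mul, map_pow, map_natCast]
    ring
  rw [e, finsetSum_coeff, Finset.mul_sum]
  have hsub : Finset.range (j / 2 + 1) ⊆ Finset.range (m + j + 1) := by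
    intro k; simp only [Finset.mem_range]; omega
  rw [← Finset.sum_subset hsub]
  · refine Finset.sum_congr rfl fun k hk => ?_
    have hk : 2 * k ≤ j := by rw [Finset.mem_range] at hk; omega
    obtain ⟨i, rfl⟩ := Nat.exists_eq_add_of_le hk
    rw [coeff_C_mul, show m + (2 * k + i) + m = (m + k) + (m + (2 * k + i) - k) by omega,
      coeff_mul_X_pow, coeff_X_add_C_pow,
      Nat.cast_choose ℝ (show k ≤ m + (2 * k + i) by omega),
      Nat.cast_choose ℝ (show m + k ≤ m + (2 * k + i) - k by omega),
      show m + (2 * k + i) - k - (m + k) = i by omega]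
    unfold solidCoeff
    rw [show 2 * k + i - 2 * k = i by omega, neg_pow, mul_pow]
    have := Nat.factorial_ne_zero (m + (2 * k + i) - k)
    field_simp
  · intro k hk hk'
    simp only [Finset.mem_range] at hk hk'
    rw [coeff_C_mul, show m + j + m = (m + k) + (m + j - k) by omega, coeff_mul_X_pow,
      coeff_X_add_C_pow, Nat.choose_eq_zero_of_lt (show m + j - k < m + k by omega)]
    simp

open Polynomial in
lemma exists_derivative_legendre_eq (m j : ℕ) :
    ∃ c : ℝ, c ≠ 0 ∧ derivative^[m] (legendre (m + j)) =
      C c * ∑ k ∈ Finset.range (j / 2 + 1),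
        C (solidCoeff m j k) * ((1 - X ^ 2) ^ k * X ^ (j - 2 * k)) := by
  refine ⟨1 / ((2 : ℝ) ^ (m + j) * ((m + j).factorial : ℝ)) *
    ((m + j + m).factorial * (m + j).factorial), by positivity, ?_⟩
  refine Polynomial.funext fun r => ?_
  have h := hasseDeriv_eval_sq_sub_one_pow m j r
  rw [legendre, iterate_derivative_C_mul, ← Function.iterate_add_apply, add_comm m (m + j),
    ← factorial_smul_hasseDeriv, LinearMap.smul_apply, eval_mul, eval_smul, h]
  simp only [eval_mul, eval_C, nsmul_eq_mul, eval_finsetSum,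
    eval_pow, eval_sub, eval_one, eval_X, mul_assoc]

/-- A form in `s` and `t`, of weight `2` in `t`, is divisible by `s - 2 t²` if it vanishes at
`s = 2`, `t = 1`. -/
lemma dvd_sum_of_sum_eq_zero {R : Type*} [CommRing R] (f : ℝ →+* R) (j : ℕ) (a : ℕ → ℝ)
    (h : ∑ k ∈ Finset.range (j / 2 + 1), a k * 2 ^ k = 0) (s t : R) :
    s - 2 * t ^ 2 ∣ ∑ k ∈ Finset.range (j / 2 + 1), f (a k) * (s ^ k * t ^ (j - 2 * k)) := by
  have e : ∑ k ∈ Finset.range (j / 2 + 1), f (a k) * ((2 * t ^ 2) ^ k * t ^ (j - 2 * k)) = 0 := by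
    have : ∑ k ∈ Finset.range (j / 2 + 1), f (a k) * ((2 * t ^ 2) ^ k * t ^ (j - 2 * k)) =
        f (∑ k ∈ Finset.range (j / 2 + 1), a k * 2 ^ k) * t ^ j := by
      rw [map_sum, Finset.sum_mul]
      refine Finset.sum_congr rfl fun k hk => ?_
      have hk : 2 * k ≤ j := by rw [Finset.mem_range] at hk; omega
      obtain ⟨i, rfl⟩ := Nat.exists_eq_add_of_le hk
      rw [show 2 * k + i - 2 * k = i by omega, map_mul, map_pow, map_ofNat, mul_pow]
      ring
    rw [this, h, map_zero, zero_mul]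
  rw [← sub_zero (∑ k ∈ _, _), ← e, ← Finset.sum_sub_distrib]
  refine Finset.dvd_sum fun k _ => ?_
  rw [← mul_sub, ← sub_mul]
  exact ((sub_dvd_pow_sub_pow s (2 * t ^ 2) k).mul_right _).mul_left _

open Polynomial in
lemma legendre_two : legendre 2 = C (1 / 2) * (3 * X ^ 2 - 1) := by
  have h : derivative^[2] ((X ^ 2 - 1 : ℝ[X]) ^ 2) = C 4 * (3 * X ^ 2 - 1) := by
    rw [show ((X ^ 2 - 1 : ℝ[X]) ^ 2) = X ^ 4 - C 2 * X ^ 2 + 1 by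
      rw [map_ofNat]; ring]
    simp [derivative_pow]
    simp only [map_ofNat]
    ring
  rw [legendre, h, ← mul_assoc, ← C_mul]
  norm_num

open Polynomial in
theorem legendreTwoDvd_iff (m j : ℕ) : LegendreTwoDvd (m + j) m ↔ coneValue m j = 0 := by
  obtain ⟨c, hc, hD⟩ := exists_derivative_legendre_eq m j
  constructor
  · rintro ⟨Q, hQ, hdvd⟩
    set x : ℝ := √(1 / 3)
    have hx2 : x ^ 2 = 1 / 3 := Real.sq_sqrt (by norm_num)
    have hx0 : 0 < x := Real.sqrt_pos.2 (by norm_num)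
    have hx1 : x ≤ 1 := by nlinarith
    have hs : √(1 - x ^ 2) ≠ 0 := (Real.sqrt_pos.2 (by rw [hx2]; norm_num)).ne'
    have hQ0 : Q.eval x = 0 := by
      obtain ⟨R, rfl⟩ := hdvd
      rw [legendre_two]
      simp [hx2]
    have h := hQ x ⟨by linarith, hx1⟩
    rw [hQ0, mul_zero, assocLegendre, hD] at h
    have h' : (C c * ∑ k ∈ Finset.range (j / 2 + 1),
        C (solidCoeff m j k) * ((1 - X ^ 2) ^ k * X ^ (j - 2 * k)) : ℝ[X]).eval x =
        c * (x ^ j * coneValue m j) := by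
      simp only [eval_mul, eval_C, eval_finsetSum, eval_pow, eval_sub, eval_one, eval_X, coneValue,
        Finset.mul_sum]
      refine Finset.sum_congr rfl fun k hk => ?_
      have hk : 2 * k ≤ j := by rw [Finset.mem_range] at hk; omega
      obtain ⟨i, rfl⟩ := Nat.exists_eq_add_of_le hk
      -- At x = 1/√3 the form in 1 - x² and x becomes x^j times its value at (2, 1).
      rw [show 2 * k + i - 2 * k = i by omega, show 1 - x ^ 2 = 2 * x ^ 2 by rw [hx2]; norm_num]
      ring
    rw [h'] at h
    simpa [hs, hc, hx0.ne'] using h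
  · intro h
    refine ⟨(-1) ^ m * (1 - X ^ 2) ^ (m / 2) * derivative^[m] (legendre (m + j)), ?_, ?_⟩
    · rintro x ⟨hx1, hx2⟩
      have hx : 0 ≤ 1 - x ^ 2 := by nlinarith
      rw [assocLegendre]
      conv_lhs => rw [← Nat.mod_add_div m 2]
      simp only [eval_mul, eval_pow, eval_neg, eval_one, eval_sub, eval_X]
      rw [pow_add (√(1 - x ^ 2)), pow_mul (√(1 - x ^ 2)), Real.sq_sqrt hx, Nat.mod_add_div]
      ring
    · refine Dvd.dvd.mul_left ?_ _
      rw [hD, legendre_two]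
      refine Dvd.dvd.mul_left ?_ _
      have h1 := dvd_sum_of_sum_eq_zero (C : ℝ →+* ℝ[X]) j (solidCoeff m j) h (1 - X ^ 2) X
      -- (1 - X²) - 2X² = 1 - 3X² = -2 P₂.
      refine dvd_trans ⟨C (-2), ?_⟩ h1
      have : (C (1 / 2) * C (-2) : ℝ[X]) = -1 := by
        rw [← C_mul]; norm_num
      linear_combination (-(3 * X ^ 2 - 1) : ℝ[X]) * this

end HarmonicCone

/-! ### The formal Laplacian and homogeneous components -/

namespace HarmonicCone

open MvPolynomial InnerProductSpace
open scoped Laplacian Topology ContDiff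

/-- The formal Laplacian. -/
noncomputable def lapl : MvPolynomial (Fin 3) ℝ →ₗ[ℝ] MvPolynomial (Fin 3) ℝ :=
  ∑ i, (pderiv i).toLinearMap ∘ₗ (pderiv i).toLinearMap

lemma lapl_apply (h : MvPolynomial (Fin 3) ℝ) :
    lapl h = pderiv 0 (pderiv 0 h) + pderiv 1 (pderiv 1 h) + pderiv 2 (pderiv 2 h) := by
  simp [lapl, Fin.sum_univ_three]

@[simp] lemma polyFun_add (p q : MvPolynomial (Fin 3) ℝ) :
    polyFun (p + q) = polyFun p + polyFun q := by
  ext v; simp [polyFun]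

@[simp] lemma polyFun_mul (p q : MvPolynomial (Fin 3) ℝ) :
    polyFun (p * q) = polyFun p * polyFun q := by
  ext v; simp [polyFun]

@[simp] lemma polyFun_X (i : Fin 3) : polyFun (X i) = fun v => v i := by
  ext v; simp [polyFun]

lemma polyFun_injective : Function.Injective polyFun := fun p q h =>
  MvPolynomial.funext fun x => by simpa [polyFun] using congrFun h (WithLp.toLp 2 x)

lemma hasFDerivAt_polyFun (h : MvPolynomial (Fin 3) ℝ) (v : Space) :
    HasFDerivAt (polyFun h)
      (∑ i, polyFun (pderiv i h) v • (EuclideanSpace.proj i : Space →L[ℝ] ℝ)) v := by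
  induction h using MvPolynomial.induction_on with
  | C a =>
    have : polyFun (C a) = fun _ => a := by ext w; simp [polyFun]
    rw [this]
    exact (hasFDerivAt_const a v).congr_fderiv (by simp [polyFun])
  | add p q hp hq =>
    rw [polyFun_add]
    exact (hp.add hq).congr_fderiv (by simp [add_smul, Finset.sum_add_distrib])
  | mul_X p j hp =>
    have hj : HasFDerivAt (fun w : Space => w j) (EuclideanSpace.proj j : Space →L[ℝ] ℝ) v :=
      (EuclideanSpace.proj j : Space →L[ℝ] ℝ).hasFDerivAt
    rw [polyFun_mul, polyFun_X]
    refine (hp.mul hj).congr_fderiv ?_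
    ext w
    have h0 : polyFun 0 v = 0 := by simp [polyFun]
    have h1 : polyFun 1 v = 1 := by simp [polyFun]
    fin_cases j <;> simp [Fin.sum_univ_three, h0, h1] <;> ring

lemma fderiv_polyFun (h : MvPolynomial (Fin 3) ℝ) (i : Fin 3) :
    (fun v => fderiv ℝ (polyFun h) v (EuclideanSpace.single i 1)) = polyFun (pderiv i h) := by
  ext v
  rw [(hasFDerivAt_polyFun h v).fderiv]
  simp

lemma analyticOnNhd_polyFun (h : MvPolynomial (Fin 3) ℝ) :
    AnalyticOnNhd ℝ (polyFun h) Set.univ :=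
  AnalyticOnNhd.eval_continuousLinearMap' (fun i => (EuclideanSpace.proj i : Space →L[ℝ] ℝ)) h

lemma contDiff_polyFun (h : MvPolynomial (Fin 3) ℝ) {n : WithTop ℕ∞} :
    ContDiff ℝ n (polyFun h) :=
  contDiff_iff_contDiffAt.2 fun v => (analyticOnNhd_polyFun h v trivial).contDiffAt

/-- The standard formula for the Laplacian, in terms of iterated partial derivatives. -/
lemma laplacian_eq_sum_fderiv {f : Space → ℝ} {x : Space} (hf : ContDiffAt ℝ 2 f x) :
    Δ f x = ∑ i, fderiv ℝ (fun y => fderiv ℝ f y (EuclideanSpace.single i 1)) x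
      (EuclideanSpace.single i 1) := by
  rw [laplacian_eq_iteratedFDeriv_orthonormalBasis f (EuclideanSpace.basisFun (Fin 3) ℝ)]
  refine Finset.sum_congr rfl fun i _ => ?_
  have hd : DifferentiableAt ℝ (fderiv ℝ f) x :=
    (hf.fderiv_right (m := 1) (by norm_num)).differentiableAt (by norm_num)
  rw [iteratedFDeriv_two_apply, fderiv_clm_apply hd (differentiableAt_const _)]
  simp

lemma laplacian_polyFun (h : MvPolynomial (Fin 3) ℝ) : Δ (polyFun h) = polyFun (lapl h) := by
  ext v
  rw [laplacian_eq_sum_fderiv (contDiff_polyFun h).contDiffAt]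
  simp_rw [fderiv_polyFun]
  have := fun i => congrFun (fderiv_polyFun (pderiv i h) i) v
  refine (Finset.sum_congr rfl fun i _ => this i).trans ?_
  simp [lapl_apply, Fin.sum_univ_three]

lemma isHarmonicPoly_iff (h : MvPolynomial (Fin 3) ℝ) : IsHarmonicPoly h ↔ lapl h = 0 := by
  constructor
  · intro H
    refine polyFun_injective (funext fun v => ?_)
    rw [← laplacian_polyFun, (H v trivial).2.self_of_nhds]
    simp [polyFun]
  · intro H v _
    refine ⟨(contDiff_polyFun h).contDiffAt, ?_⟩
    rw [laplacian_polyFun, H]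
    exact Filter.Eventually.of_forall fun w => by simp [polyFun]

lemma homogeneousComponent_pderiv (h : MvPolynomial (Fin 3) ℝ) (i : Fin 3) (n : ℕ) :
    homogeneousComponent n (pderiv i h) = pderiv i (homogeneousComponent (n + 1) h) := by
  classical
  ext d
  simp only [coeff_homogeneousComponent, coeff_pderiv, map_add,
    Finsupp.degree_single, add_left_inj]
  split_ifs <;> simp

/-- The Laplacian lowers degree by exactly two, so components of different degrees cannot cancel.
Degrees 0 and 1 are separate, being killed by any two derivatives. -/
lemma lapl_homogeneousComponent {h : MvPolynomial (Fin 3) ℝ} (H : lapl h = 0) (n : ℕ) :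
    lapl (homogeneousComponent n h) = 0 := by
  rcases n with _ | _ | n
  · rw [homogeneousComponent_zero]; simp [lapl_apply]
  · have : ∀ i, pderiv i (pderiv i (homogeneousComponent (0 + 1) h)) = 0 := fun i => by
      rw [← homogeneousComponent_pderiv, homogeneousComponent_zero, pderiv_C]
    simp only [lapl_apply, this, add_zero]
  · have := congrArg (homogeneousComponent n) H
    rw [lapl_apply] at this ⊢
    simpa only [map_add, homogeneousComponent_pderiv, map_zero] using this

lemma polyFun_homogeneous_smul {q : MvPolynomial (Fin 3) ℝ} {n : ℕ} (hq : q.IsHomogeneous n)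
    (t : ℝ) (v : Space) : polyFun q (t • v) = t ^ n * polyFun q v := by
  simp only [polyFun, eval_eq', Finset.mul_sum]
  refine Finset.sum_congr rfl fun d hd => ?_
  have hd : ∑ i, d i = n := by
    rw [← Finsupp.degree_eq_sum, Finsupp.degree_eq_weight_one]
    exact hq (mem_support_iff.1 hd)
  rw [← hd, ← Finset.prod_pow_eq_pow_sum]
  simp only [PiLp.smul_apply, smul_eq_mul, mul_pow, Finset.prod_mul_distrib]
  ring

lemma polyFun_smul_eq_sum (q : MvPolynomial (Fin 3) ℝ) (t : ℝ) (v : Space) :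
    polyFun q (t • v) =
      ∑ n ∈ Finset.range (q.totalDegree + 1), polyFun (homogeneousComponent n q) v * t ^ n := by
  conv_lhs => rw [← sum_homogeneousComponent q]
  have : ∀ (s : Finset ℕ) (f : ℕ → MvPolynomial (Fin 3) ℝ) (w : Space),
      polyFun (∑ n ∈ s, f n) w = ∑ n ∈ s, polyFun (f n) w := fun s f w => by simp [polyFun]
  rw [this]
  exact Finset.sum_congr rfl fun n _ => by
    rw [polyFun_homogeneous_smul (homogeneousComponent_isHomogeneous n q), mul_comm]

/-- If a polynomial vanishes on a line through the origin, so do its homogeneous components. -/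
lemma polyFun_homogeneousComponent_eq_zero {q : MvPolynomial (Fin 3) ℝ} {v : Space}
    (h : ∀ t : ℝ, polyFun q (t • v) = 0) (n : ℕ) : polyFun (homogeneousComponent n q) v = 0 := by
  by_cases hn : q.totalDegree < n
  · rw [homogeneousComponent_eq_zero n q hn]; simp [polyFun]
  have : (∑ n ∈ Finset.range (q.totalDegree + 1),
      Polynomial.C (polyFun (homogeneousComponent n q) v) * Polynomial.X ^ n) = 0 := by
    refine Polynomial.funext fun t => ?_
    rw [Polynomial.eval_zero, ← h t, polyFun_smul_eq_sum, Polynomial.eval_finsetSum]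
    simp
  have := congrArg (Polynomial.coeff · n) this
  simpa [Polynomial.finsetSum_coeff, Polynomial.coeff_C_mul, Polynomial.coeff_X_pow,
    Nat.lt_succ_iff, not_lt.1 hn] using this

end HarmonicCone

/-! ### Solid harmonics -/

namespace HarmonicCone

open MvPolynomial

/-- The real and imaginary parts of `(x + i y)^m`. -/
noncomputable def reImPow : ℕ → MvPolynomial (Fin 3) ℝ × MvPolynomial (Fin 3) ℝ
  | 0 => (1, 0)
  | m + 1 => (X 0 * (reImPow m).1 - X 1 * (reImPow m).2, X 0 * (reImPow m).2 + X 1 * (reImPow m).1)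

lemma pderiv_zero_reImPow (m : ℕ) :
    pderiv 0 (reImPow (m + 1)).1 = (m + 1 : ℕ) * (reImPow m).1 ∧
    pderiv 0 (reImPow (m + 1)).2 = (m + 1 : ℕ) * (reImPow m).2 := by
  induction m with
  | zero => simp [reImPow]
  | succ m ih =>
    rw [reImPow]
    simp only [map_sub, map_add, Derivation.leibniz, smul_eq_mul, pderiv_X_self, ih.1, ih.2,
      pderiv_X_of_ne (show (1 : Fin 3) ≠ 0 by decide)]
    rw [reImPow]
    push_cast
    constructor <;> ring

lemma pderiv_one_reImPow (m : ℕ) :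
    pderiv 1 (reImPow (m + 1)).1 = -((m + 1 : ℕ) * (reImPow m).2) ∧
    pderiv 1 (reImPow (m + 1)).2 = (m + 1 : ℕ) * (reImPow m).1 := by
  induction m with
  | zero => simp [reImPow]
  | succ m ih =>
    rw [reImPow]
    simp only [map_sub, map_add, Derivation.leibniz, smul_eq_mul, pderiv_X_self, ih.1, ih.2,
      pderiv_X_of_ne (show (0 : Fin 3) ≠ 1 by decide)]
    rw [reImPow]
    push_cast
    constructor <;> ring

lemma pderiv_two_reImPow (m : ℕ) :
    pderiv 2 (reImPow m).1 = 0 ∧ pderiv 2 (reImPow m).2 = 0 := by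
  induction m with
  | zero => simp [reImPow]
  | succ m ih =>
    rw [reImPow]
    simp [ih, pderiv_X_of_ne (show (0 : Fin 3) ≠ 2 by decide),
      pderiv_X_of_ne (show (1 : Fin 3) ≠ 2 by decide)]

lemma reImPow_isHomogeneous (m : ℕ) :
    (reImPow m).1.IsHomogeneous m ∧ (reImPow m).2.IsHomogeneous m := by
  induction m with
  | zero => exact ⟨isHomogeneous_one _ _, isHomogeneous_zero _ _ _⟩
  | succ m ih =>
    rw [reImPow, add_comm m 1]
    exact ⟨((isHomogeneous_X _ _).mul ih.1).sub ((isHomogeneous_X _ _).mul ih.2),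
      ((isHomogeneous_X _ _).mul ih.2).add ((isHomogeneous_X _ _).mul ih.1)⟩

/-- Euler's identity for the real part of `(x + i y)^m`. -/
lemma euler_reImPow (m : ℕ) :
    X 0 * pderiv 0 (reImPow m).1 + X 1 * pderiv 1 (reImPow m).1 = (m : MvPolynomial (Fin 3) ℝ) * (reImPow m).1 := by
  rcases m with _ | m
  · simp [reImPow]
  · rw [(pderiv_zero_reImPow m).1, (pderiv_one_reImPow m).1, reImPow]
    ring

lemma laplace_two_reImPow (m : ℕ) :
    pderiv 0 (pderiv 0 (reImPow m).1) + pderiv 1 (pderiv 1 (reImPow m).1) = 0 := by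
  rcases m with _ | _ | m
  · simp [reImPow]
  · simp [reImPow]
  · rw [(pderiv_zero_reImPow _).1, (pderiv_one_reImPow _).1]
    simp only [map_neg, Derivation.leibniz, smul_eq_mul, (pderiv_zero_reImPow _).1,
      (pderiv_one_reImPow _).2]
    simp

/-- With ρ = x² + y² and R = Re (x + iy)^m, the planar Laplacian of ρ^k gives 4k² ρ^(k-1) and the
cross term 2∇ρ^k · ∇R gives 4km ρ^(k-1) R by Euler's identity; R itself is harmonic. -/
lemma lapl_reImPow_mul (m k j : ℕ) :
    lapl ((reImPow m).1 * ((X 0 ^ 2 + X 1 ^ 2) ^ k * X 2 ^ j)) =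
      (reImPow m).1 * (((4 * k * (m + k) : ℕ) : MvPolynomial (Fin 3) ℝ) * ((X 0 ^ 2 + X 1 ^ 2) ^ (k - 1) * X 2 ^ j) +
        ((j * (j - 1) : ℕ) : MvPolynomial (Fin 3) ℝ) * ((X 0 ^ 2 + X 1 ^ 2) ^ k * X 2 ^ (j - 2))) := by
  have h0 := laplace_two_reImPow m
  have h1 := euler_reImPow m
  have h2 := (pderiv_two_reImPow m).1
  generalize (reImPow m).1 = R at *
  have d01 : pderiv (0 : Fin 3) (X 1 : MvPolynomial (Fin 3) ℝ) = 0 := pderiv_X_of_ne (by decide)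
  have d02 : pderiv (0 : Fin 3) (X 2 : MvPolynomial (Fin 3) ℝ) = 0 := pderiv_X_of_ne (by decide)
  have d10 : pderiv (1 : Fin 3) (X 0 : MvPolynomial (Fin 3) ℝ) = 0 := pderiv_X_of_ne (by decide)
  have d12 : pderiv (1 : Fin 3) (X 2 : MvPolynomial (Fin 3) ℝ) = 0 := pderiv_X_of_ne (by decide)
  have d20 : pderiv (2 : Fin 3) (X 0 : MvPolynomial (Fin 3) ℝ) = 0 := pderiv_X_of_ne (by decide)
  have d21 : pderiv (2 : Fin 3) (X 1 : MvPolynomial (Fin 3) ℝ) = 0 := pderiv_X_of_ne (by decide)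
  rw [lapl_apply]
  simp only [Derivation.leibniz, Derivation.leibniz_pow, map_add, smul_eq_mul, nsmul_eq_mul,
    pderiv_X_self, d01, d02, d10, d12, d20, d21, h2, map_zero, Derivation.map_natCast,
    Derivation.map_one_eq_zero]
  have e1 (n : ℕ) : n + 1 + 1 - 1 = n + 1 := rfl
  have e2 (n : ℕ) : n + 1 + 1 - 2 = n := rfl
  have e3 : (0 + 1 - 1 : ℕ) = 0 := rfl
  have e4 (n : ℕ) : n + 1 - 1 = n := rfl
  -- The exponents k - 1 and j - 2 are truncated; whenever truncation occurs the coefficient in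
  -- front is zero.
  rcases k with _ | _ | k <;> rcases j with _ | _ | j <;> simp only [e1, e2, e3, e4] <;>
    push_cast
  · linear_combination h0
  · linear_combination X 2 * h0
  · linear_combination X 2 ^ (j + 2) * h0
  · linear_combination (X 0 ^ 2 + X 1 ^ 2) * h0 + 4 * h1
  · linear_combination X 2 * ((X 0 ^ 2 + X 1 ^ 2) * h0 + 4 * h1)
  · linear_combination X 2 ^ (j + 2) * ((X 0 ^ 2 + X 1 ^ 2) * h0 + 4 * h1)
  · linear_combination (X 0 ^ 2 + X 1 ^ 2) ^ (k + 2) * h0 +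
      4 * (k + 2) * (X 0 ^ 2 + X 1 ^ 2) ^ (k + 1) * h1
  · linear_combination X 2 * ((X 0 ^ 2 + X 1 ^ 2) ^ (k + 2) * h0 +
      4 * (k + 2) * (X 0 ^ 2 + X 1 ^ 2) ^ (k + 1) * h1)
  · linear_combination X 2 ^ (j + 2) * ((X 0 ^ 2 + X 1 ^ 2) ^ (k + 2) * h0 +
      4 * (k + 2) * (X 0 ^ 2 + X 1 ^ 2) ^ (k + 1) * h1)

/-- The solid harmonic polynomial of degree `m + j` that corresponds to the associated Legendre
function `P_(m + j)^m`, up to normalization. -/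
noncomputable def solidHarmonic (m j : ℕ) : MvPolynomial (Fin 3) ℝ :=
  (reImPow m).1 * ∑ k ∈ Finset.range (j / 2 + 1),
    C (solidCoeff m j k) * ((X 0 ^ 2 + X 1 ^ 2) ^ k * X 2 ^ (j - 2 * k))

lemma lapl_solidHarmonic (m j : ℕ) : lapl (solidHarmonic m j) = 0 := by
  have e : solidHarmonic m j = ∑ k ∈ Finset.range (j / 2 + 1), solidCoeff m j k •
      ((reImPow m).1 * ((X 0 ^ 2 + X 1 ^ 2) ^ k * X 2 ^ (j - 2 * k))) := by
    rw [solidHarmonic, Finset.mul_sum]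
    refine Finset.sum_congr rfl fun k _ => ?_
    rw [smul_eq_C_mul]
    ring
  simp only [e, map_sum, map_smul, lapl_reImPow_mul]
  simp only [smul_eq_C_mul, mul_add, Finset.sum_add_distrib]
  -- The term k = 0 of the first sum and the last term of the second have zero coefficient. The rest
  -- cancels after pairing k + 1 with k.
  rw [Finset.sum_range_succ', Finset.sum_range_succ _ (j / 2)]
  have h0 : ((j - 2 * (j / 2)) * (j - 2 * (j / 2) - 1) : ℕ) = 0 := by
    rcases Nat.mod_two_eq_zero_or_one j with h | h
    · rw [show j - 2 * (j / 2) = 0 by omega, zero_mul]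
    · rw [show j - 2 * (j / 2) - 1 = 0 by omega, mul_zero]
  rw [h0]
  simp only [mul_zero, zero_mul, Nat.cast_zero, add_zero]
  rw [← Finset.sum_add_distrib]
  refine Finset.sum_eq_zero fun k hk => ?_
  have hk : 2 * (k + 1) ≤ j := by rw [Finset.mem_range] at hk; omega
  have h := congrArg (C : ℝ → MvPolynomial (Fin 3) ℝ) (solidCoeff_succ m j k hk)
  rw [show k + 1 - 1 = k by omega, show j - 2 * (k + 1) = j - 2 * k - 2 by omega]
  simp only [map_mul, map_add, map_neg, map_natCast, map_ofNat, map_one] at h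
  push_cast
  linear_combination
    ((reImPow m).1 * ((X 0 ^ 2 + X 1 ^ 2) ^ k * X 2 ^ (j - 2 * k - 2))) * h

lemma solidHarmonic_isHomogeneous (m j : ℕ) : (solidHarmonic m j).IsHomogeneous (m + j) := by
  refine (reImPow_isHomogeneous m).1.mul (IsHomogeneous.sum _ _ _ fun k hk => ?_)
  have hk : 2 * k + (j - 2 * k) = j := by rw [Finset.mem_range] at hk; omega
  refine IsHomogeneous.C_mul ?_ _
  have := ((((isHomogeneous_X ℝ (0 : Fin 3)).pow 2).add ((isHomogeneous_X ℝ (1 : Fin 3)).pow 2)).pow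
    k).mul ((isHomogeneous_X ℝ (2 : Fin 3)).pow (j - 2 * k))
  simpa only [one_mul, hk] using this

lemma solidHarmonic_ne_zero (m j : ℕ) : solidHarmonic m j ≠ 0 := by
  intro h
  -- At (X, 0, 1) the k-th summand becomes a multiple of X^(m + 2k), so the coefficient of X^m is
  -- `solidCoeff m j 0`.
  have hR : ∀ m, aeval ![(Polynomial.X : Polynomial ℝ), 0, 1] (reImPow m).1 = Polynomial.X ^ m ∧
      aeval ![(Polynomial.X : Polynomial ℝ), 0, 1] (reImPow m).2 = 0 := by
    intro m
    induction m with
    | zero => simp [reImPow]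
    | succ m ih => simp [reImPow, ih, pow_succ']
  have := congrArg (fun p => (aeval ![(Polynomial.X : Polynomial ℝ), 0, 1] p).coeff m) h
  simp only [solidHarmonic, map_mul, map_sum, map_add, map_pow, aeval_X, hR, aeval_C,
    Matrix.cons_val_zero, Matrix.cons_val_one, Matrix.cons_val, one_pow, mul_one, map_zero,
    Polynomial.coeff_zero, Polynomial.coeff_X_pow_mul', Polynomial.finsetSum_coeff] at this
  rw [Finset.sum_range_succ', Finset.sum_eq_zero] at this
  · exact solidCoeff_zero_ne_zero m j (by simpa using this)
  · intro k _
    simp [Polynomial.algebraMap_eq, ← pow_mul, Polynomial.coeff_X_pow]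

lemma conePoly_dvd_solidHarmonic {m j : ℕ} (h : coneValue m j = 0) :
    conePoly ∣ solidHarmonic m j :=
  (dvd_sum_of_sum_eq_zero (C : ℝ →+* MvPolynomial (Fin 3) ℝ) j (solidCoeff m j) h
    (X 0 ^ 2 + X 1 ^ 2) (X 2)).mul_left _

end HarmonicCone

/-! ### Fourier modes of a harmonic polynomial vanishing on the cone -/

namespace HarmonicCone

open MvPolynomial Complex

/-- The change of variables `x = (w + w') / 2`, `y = (w - w') / (2 i)`. -/
noncomputable def toComplex : MvPolynomial (Fin 3) ℝ →ₐ[ℝ] MvPolynomial (Fin 3) ℂ :=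
  aeval ![C (1 / 2) * (X 0 + X 1), C (-I / 2) * (X 0 - X 1), X 2]

lemma pderiv_toComplex (h : MvPolynomial (Fin 3) ℝ) :
    pderiv 0 (toComplex h) =
      C (1 / 2) * toComplex (pderiv 0 h) + C (-I / 2) * toComplex (pderiv 1 h) ∧
    pderiv 1 (toComplex h) =
      C (1 / 2) * toComplex (pderiv 0 h) + C (I / 2) * toComplex (pderiv 1 h) ∧
    pderiv 2 (toComplex h) = toComplex (pderiv 2 h) := by
  have d01 : pderiv (0 : Fin 3) (X 1 : MvPolynomial (Fin 3) ℂ) = 0 := pderiv_X_of_ne (by decide)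
  have d02 : pderiv (0 : Fin 3) (X 2 : MvPolynomial (Fin 3) ℂ) = 0 := pderiv_X_of_ne (by decide)
  have d10 : pderiv (1 : Fin 3) (X 0 : MvPolynomial (Fin 3) ℂ) = 0 := pderiv_X_of_ne (by decide)
  have d12 : pderiv (1 : Fin 3) (X 2 : MvPolynomial (Fin 3) ℂ) = 0 := pderiv_X_of_ne (by decide)
  have d20 : pderiv (2 : Fin 3) (X 0 : MvPolynomial (Fin 3) ℂ) = 0 := pderiv_X_of_ne (by decide)
  have d21 : pderiv (2 : Fin 3) (X 1 : MvPolynomial (Fin 3) ℂ) = 0 := pderiv_X_of_ne (by decide)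
  have f01 : pderiv (0 : Fin 3) (X 1 : MvPolynomial (Fin 3) ℝ) = 0 := pderiv_X_of_ne (by decide)
  have f02 : pderiv (0 : Fin 3) (X 2 : MvPolynomial (Fin 3) ℝ) = 0 := pderiv_X_of_ne (by decide)
  have f10 : pderiv (1 : Fin 3) (X 0 : MvPolynomial (Fin 3) ℝ) = 0 := pderiv_X_of_ne (by decide)
  have f12 : pderiv (1 : Fin 3) (X 2 : MvPolynomial (Fin 3) ℝ) = 0 := pderiv_X_of_ne (by decide)
  have f20 : pderiv (2 : Fin 3) (X 0 : MvPolynomial (Fin 3) ℝ) = 0 := pderiv_X_of_ne (by decide)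
  have f21 : pderiv (2 : Fin 3) (X 1 : MvPolynomial (Fin 3) ℝ) = 0 := pderiv_X_of_ne (by decide)
  have x0 : toComplex (X 0) = C (1 / 2) * (X 0 + X 1) := by simp [toComplex]
  have x1 : toComplex (X 1) = C (-I / 2) * (X 0 - X 1) := by simp [toComplex]
  have x2 : toComplex (X 2) = X 2 := by simp [toComplex]
  induction h using MvPolynomial.induction_on with
  | C a =>
    have : toComplex (C a) = C (a : ℂ) := by
      rw [toComplex, aeval_C]; rfl
    simp [this]
  | add p q hp hq =>
    refine ⟨?_, ?_, ?_⟩ <;> simp only [map_add, hp, hq] <;> ring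
  | mul_X p i hp =>
    obtain ⟨h0, h1, h2⟩ := hp
    refine ⟨?_, ?_, ?_⟩ <;> fin_cases i <;>
    simp only [Fin.zero_eta, Fin.mk_one, Fin.reduceFinMk, map_mul, Derivation.leibniz, smul_eq_mul,
      x0, x1, x2, h0, h1, h2, map_add, map_sub, pderiv_C, pderiv_X_self, d01, d02, d10, d12, d20,
      d21, f01, f02, f10, f12, f20, f21, map_one, mul_zero, zero_add, add_zero, sub_zero,
      zero_sub] <;> (try simp only [neg_div, map_neg]) <;> ring

lemma pderiv_comm {R : Type*} [CommRing R] (h : MvPolynomial (Fin 3) R) :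
    pderiv 0 (pderiv 1 h) = pderiv 1 (pderiv 0 h) := by
  ext d
  simp only [coeff_pderiv, Finsupp.add_apply, Finsupp.single_apply]
  rw [add_right_comm]
  simp
  ring

/-- In these coordinates ∂x² + ∂y² = 4 ∂w ∂w', so Laplace's equation links only monomials with the
same exponent difference. -/
lemma laplace_toComplex {h : MvPolynomial (Fin 3) ℝ} (H : lapl h = 0) :
    4 * pderiv 0 (pderiv 1 (toComplex h)) + pderiv 2 (pderiv 2 (toComplex h)) = 0 := by
  have e := congrArg toComplex H
  rw [lapl_apply, map_add, map_add, map_zero] at e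
  obtain ⟨-, h1, h2⟩ := pderiv_toComplex h
  rw [h1, h2, map_add, pderiv_C_mul, pderiv_C_mul, (pderiv_toComplex _).1, (pderiv_toComplex _).1,
    (pderiv_toComplex _).2.2, pderiv_comm]
  have c1 : (4 * (C (1 / 2) * C (1 / 2)) : MvPolynomial (Fin 3) ℂ) = 1 := by
    rw [← map_ofNat C 4, ← C_mul, ← C_mul, ← C_1]; norm_num
  have c2 : (C (1 / 2) * C (-I / 2) + C (I / 2) * C (1 / 2) : MvPolynomial (Fin 3) ℂ) = 0 := by
    rw [← C_mul, ← C_mul, ← C_add, ← C_0]; congr 1; ring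
  have c3 : (4 * (C (I / 2) * C (-I / 2)) : MvPolynomial (Fin 3) ℂ) = 1 := by
    rw [← map_ofNat C 4, ← C_mul, ← C_mul, ← C_1]; congr 1; linear_combination -I_sq
  linear_combination e + c1 * toComplex (pderiv 0 (pderiv 0 h)) +
    c3 * toComplex (pderiv 1 (pderiv 1 h)) + 4 * c2 * toComplex (pderiv 1 (pderiv 0 h))

lemma eval_toComplex (h : MvPolynomial (Fin 3) ℝ) (x y z : ℝ) :
    eval ![(x : ℂ) + y * I, x - y * I, z] (toComplex h) = (eval ![x, y, z] h : ℝ) := by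
  have : ((aeval ![(x : ℂ) + y * I, x - y * I, z]).restrictScalars ℝ).comp toComplex =
      (Complex.ofRealAm.comp (aeval ![x, y, z]) : MvPolynomial (Fin 3) ℝ →ₐ[ℝ] ℂ) := by
    ext i
    fin_cases i
    · simp [toComplex]; ring
    · simp [toComplex]; linear_combination (-(y : ℂ)) * I_sq
    · simp [toComplex]
  have := DFunLike.congr_fun this h
  simpa [aeval_eq_eval] using this

lemma toComplex_injective : Function.Injective toComplex := by
  intro p q h
  refine MvPolynomial.funext fun v => ?_
  have := eval_toComplex p (v 0) (v 1) (v 2)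
  rw [h, eval_toComplex, Complex.ofReal_inj] at this
  have hv : ![v 0, v 1, v 2] = v := by ext i; fin_cases i <;> rfl
  rw [hv] at this
  exact this.symm

lemma toComplex_isHomogeneous {h : MvPolynomial (Fin 3) ℝ} {n : ℕ} (H : h.IsHomogeneous n) :
    (toComplex h).IsHomogeneous n := by
  have := H.aeval (S := ℂ) (τ := Fin 3)
    ![C (1 / 2) * (X 0 + X 1), C (-I / 2) * (X 0 - X 1), X 2] (n := 1) ?_
  · simpa only [toComplex, one_mul] using this
  · intro i
    fin_cases i
    · exact ((isHomogeneous_X _ _).add (isHomogeneous_X _ _)).C_mul _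
    · exact ((isHomogeneous_X _ _).sub (isHomogeneous_X _ _)).C_mul _
    · exact isHomogeneous_X _ _

/-- The recurrence has a one-dimensional solution space, spanned by `solidCoeff m j`; the sum
condition then reads γ 0 * `coneValue m j` = 0. -/
lemma eq_zero_of_recurrence (m j : ℕ) (hA : coneValue m j ≠ 0) (γ : ℕ → ℂ)
    (hrec : ∀ k, 2 * (k + 1) ≤ j → 4 * ((k : ℂ) + 1) * (m + k + 1) * γ (k + 1) =
      -((j - 2 * k : ℕ) * (j - 2 * k - 1 : ℕ) * γ k))
    (hsum : ∑ k ∈ Finset.range (j / 2 + 1), γ k * 2 ^ k = 0) (k : ℕ) (hk : 2 * k ≤ j) :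
    γ k = 0 := by
  have hb : (solidCoeff m j 0 : ℂ) ≠ 0 := by exact_mod_cast solidCoeff_zero_ne_zero m j
  have key : ∀ k, 2 * k ≤ j → γ k * solidCoeff m j 0 = γ 0 * solidCoeff m j k := by
    intro k
    induction k with
    | zero => intro _; rfl
    | succ k ih =>
      intro hk
      have h1 := ih (by omega)
      have h2 := hrec k hk
      have h3 : 4 * ((k : ℂ) + 1) * (m + k + 1) * solidCoeff m j (k + 1) =
          -((j - 2 * k : ℕ) * (j - 2 * k - 1 : ℕ) * solidCoeff m j k) := by
        exact_mod_cast congrArg (Complex.ofReal) (solidCoeff_succ m j k hk)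
      have h4 : (4 * ((k : ℂ) + 1) * (m + k + 1)) ≠ 0 := by
        have : (4 * (k + 1) * (m + k + 1) : ℕ) ≠ 0 := by positivity
        exact_mod_cast this
      refine mul_left_cancel₀ h4 ?_
      linear_combination (solidCoeff m j 0 : ℂ) * h2 - γ 0 * h3 -
        ((j - 2 * k : ℕ) * (j - 2 * k - 1 : ℕ) : ℂ) * h1
  have h0 : γ 0 = 0 := by
    have : γ 0 * coneValue m j = 0 := by
      rw [← zero_mul (solidCoeff m j 0 : ℂ), ← hsum, coneValue, Complex.ofReal_sum, Finset.mul_sum,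
        Finset.sum_mul]
      refine Finset.sum_congr rfl fun k hk => ?_
      have := key k (by rw [Finset.mem_range] at hk; omega)
      push_cast
      linear_combination -(2 : ℂ) ^ k * this
    exact (mul_eq_zero.1 this).resolve_right (by exact_mod_cast hA)
  have := key k hk
  rw [h0, zero_mul] at this
  exact (mul_eq_zero.1 this).resolve_right hb

/-- The exponent of the monomial `w^a w'^b z^c`. -/
noncomputable def expVec (a b c : ℕ) : Fin 3 →₀ ℕ := Finsupp.equivFunOnFinite.symm ![a, b, c]

lemma expVec_apply (a b c : ℕ) (i : Fin 3) : expVec a b c i = ![a, b, c] i := rfl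

lemma expVec_eq (d : Fin 3 →₀ ℕ) : expVec (d 0) (d 1) (d 2) = d := by
  ext i; fin_cases i <;> rfl

lemma coeff_recurrence {H : MvPolynomial (Fin 3) ℂ}
    (hH : 4 * pderiv 0 (pderiv 1 H) + pderiv 2 (pderiv 2 H) = 0) (a b c : ℕ) :
    4 * ((b : ℂ) + 1) * (a + 1) * coeff (expVec (a + 1) (b + 1) c) H =
      -((c + 2) * (c + 1) * coeff (expVec a b (c + 2)) H) := by
  have h := congrArg (coeff (expVec a b c)) hH
  rw [← map_ofNat C 4, coeff_add, coeff_C_mul, coeff_pderiv, coeff_pderiv, coeff_pderiv,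
    coeff_pderiv, coeff_zero] at h
  have e1 : expVec a b c + Finsupp.single 0 1 + Finsupp.single 1 1 = expVec (a + 1) (b + 1) c := by
    ext i; fin_cases i <;> simp [expVec_apply]
  have e2 : expVec a b c + Finsupp.single 2 1 + Finsupp.single 2 1 = expVec a b (c + 2) := by
    ext i; fin_cases i <;> simp [expVec_apply]
  rw [e1, e2] at h
  have e3 : (expVec a b c + Finsupp.single 0 1 : Fin 3 →₀ ℕ) 1 = b := by simp [expVec]
  have e4 : (expVec a b c + Finsupp.single 2 1 : Fin 3 →₀ ℕ) 2 = c + 1 := by simp [expVec]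
  have e5 : expVec a b c 0 = a := rfl
  have e6 : expVec a b c 2 = c := rfl
  rw [e3, e4, e5, e6] at h
  push_cast at h
  linear_combination h

lemma infinite_unit_circle : {t : ℂ | ‖t‖ = 1}.Infinite := by
  have : Infinite Circle := by
    rw [Circle.argEquiv.infinite_iff]
    exact (Set.Ioc_infinite (by linarith [Real.pi_pos])).to_subtype
  have h := Set.infinite_range_of_injective (f := fun z : Circle => (z : ℂ)) Circle.coe_injective
  refine h.mono ?_
  rintro _ ⟨z, rfl⟩
  exact Circle.norm_coe z

/-- The Fourier coefficients of a homogeneous polynomial that vanishes on a circle. -/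
lemma sum_coeff_eq_zero {H : MvPolynomial (Fin 3) ℂ} {m j : ℕ} (hn : H.IsHomogeneous (m + j))
    (r : ℂ) (hr : r ≠ 0)
    (hz : ∀ t : ℂ, ‖t‖ = 1 → eval ![r * t, r * t⁻¹, 1] H = 0) :
    ∑ k ∈ Finset.range (j / 2 + 1), coeff (expVec (m + k) k (j - 2 * k)) H * (r ^ 2) ^ k = 0 := by
  have hdeg : ∀ d ∈ H.support, d 0 + d 1 + d 2 = m + j := fun d hd => by
    rw [← hn (mem_support_iff.1 hd), ← Fin.sum_univ_three, ← Finsupp.degree_eq_sum,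
      Finsupp.degree_eq_weight_one]
    rfl
  -- On the circle w^a w'^b z^c equals r^(a+b) t^(a-b). Multiplying by t^(m+j) clears negative
  -- exponents and leaves a polynomial with infinitely many zeros.
  have hR : ∑ d ∈ H.support, Polynomial.C (coeff d H * r ^ (d 0 + d 1)) *
      Polynomial.X ^ (d 0 + (m + j - d 1)) = 0 := by
    refine Polynomial.eq_zero_of_infinite_isRoot _ (infinite_unit_circle.mono fun t ht => ?_)
    have ht0 : t ≠ 0 := by rintro rfl; simp at ht
    have h := hz t ht
    rw [eval_eq'] at h
    rw [Set.mem_ofPred_eq, Polynomial.IsRoot, Polynomial.eval_finsetSum,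
      ← zero_mul (t ^ (m + j)), ← h, Finset.sum_mul]
    refine Finset.sum_congr rfl fun d hd => ?_
    have hd1 : d 1 ≤ m + j := by have := hdeg d hd; omega
    simp only [Fin.prod_univ_three, Polynomial.eval_mul, Polynomial.eval_C, Polynomial.eval_pow,
      Polynomial.eval_X, Matrix.cons_val_zero, Matrix.cons_val_one, Matrix.cons_val, one_pow]
    rw [← Nat.add_sub_cancel' hd1, Nat.add_sub_cancel_left]
    simp only [mul_pow, inv_pow, pow_add]
    field_simp
  -- This coefficient selects a - b = m.
  have h := congrArg (Polynomial.coeff · (m + j + m)) hR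
  simp only [Polynomial.finsetSum_coeff, Polynomial.coeff_C_mul, Polynomial.coeff_X_pow,
    Polynomial.coeff_zero, mul_ite, mul_one, mul_zero] at h
  rw [← Finset.sum_filter] at h
  have hinj : Function.Injective fun k => expVec (m + k) k (j - 2 * k) := fun k k' hk =>
    congrArg (fun d : Fin 3 →₀ ℕ => d 1) hk
  have key : r ^ m * ∑ k ∈ Finset.range (j / 2 + 1),
      coeff (expVec (m + k) k (j - 2 * k)) H * (r ^ 2) ^ k = 0 := by
    rw [← h, Finset.sum_subset (s₂ := (Finset.range (j / 2 + 1)).image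
      fun k => expVec (m + k) k (j - 2 * k)), Finset.sum_image hinj.injOn, Finset.mul_sum]
    · refine Finset.sum_congr rfl fun k _ => ?_
      have e0 : expVec (m + k) k (j - 2 * k) 0 = m + k := rfl
      have e1 : expVec (m + k) k (j - 2 * k) 1 = k := rfl
      rw [e0, e1]
      ring
    · intro d hd
      rw [Finset.mem_filter] at hd
      have := hdeg d hd.1
      refine Finset.mem_image.2 ⟨d 1, ?_, ?_⟩
      · rw [Finset.mem_range]; omega
      · rw [show m + d 1 = d 0 by omega, show j - 2 * d 1 = d 2 by omega, expVec_eq]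
    · intro d hd hd'
      obtain ⟨k, hk, rfl⟩ := Finset.mem_image.1 hd
      rw [Finset.mem_range] at hk
      rw [Finset.mem_filter, not_and, mem_support_iff] at hd'
      by_cases hc : coeff (expVec (m + k) k (j - 2 * k)) H = 0
      · rw [hc, zero_mul]
      · refine absurd ?_ (hd' hc)
        have e0 : expVec (m + k) k (j - 2 * k) 0 = m + k := rfl
        have e1 : expVec (m + k) k (j - 2 * k) 1 = k := rfl
        rw [e0, e1]
        omega
  exact (mul_eq_zero.1 key).resolve_left (pow_ne_zero _ hr)

/-- The monomial lies in the mode m = d 0 - d 1, with j = n - m, to which the recurrence and the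
circle condition apply. -/
lemma coeff_eq_zero_of_vanishing {H : MvPolynomial (Fin 3) ℂ} {n : ℕ} (hn : H.IsHomogeneous n)
    (hH : 4 * pderiv 0 (pderiv 1 H) + pderiv 2 (pderiv 2 H) = 0)
    (hz : ∀ t : ℂ, ‖t‖ = 1 → eval ![(√2 : ℝ) * t, (√2 : ℝ) * t⁻¹, 1] H = 0)
    (hA : ∀ m j, m + j = n → coneValue m j ≠ 0) {d : Fin 3 →₀ ℕ} (hd : d 1 ≤ d 0) :
    coeff d H = 0 := by
  by_contra hc
  have hdeg : d 0 + d 1 + d 2 = n := by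
    rw [← hn hc, ← Fin.sum_univ_three, ← Finsupp.degree_eq_sum, Finsupp.degree_eq_weight_one]
    rfl
  obtain ⟨m, hm⟩ := Nat.exists_eq_add_of_le hd
  have hj : m + (2 * d 1 + d 2) = n := by omega
  have hr : (((√2 : ℝ) : ℂ)) ^ 2 = 2 := by
    rw [← Complex.ofReal_pow, Real.sq_sqrt (by norm_num)]; norm_num
  have hr0 : (((√2 : ℝ) : ℂ)) ≠ 0 := by
    intro h; rw [h] at hr; norm_num at hr
  have hs := sum_coeff_eq_zero (m := m) (j := 2 * d 1 + d 2) (by rwa [hj]) _ hr0 hz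
  rw [hr] at hs
  have := eq_zero_of_recurrence m (2 * d 1 + d 2) (hA _ _ hj)
    (fun k => coeff (expVec (m + k) k (2 * d 1 + d 2 - 2 * k)) H) ?_ hs (d 1) (by omega)
  · rw [Nat.add_sub_cancel_left, add_comm m, ← hm, expVec_eq] at this
    exact hc this
  · intro k hk
    obtain ⟨i, hi⟩ := Nat.exists_eq_add_of_le hk
    have h := coeff_recurrence hH (m + k) k i
    rw [hi, show 2 * (k + 1) + i - 2 * (k + 1) = i by omega,
      show 2 * (k + 1) + i - 2 * k = i + 2 by omega, show i + 2 - 1 = i + 1 by omega]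
    push_cast at h ⊢
    exact h

lemma conePoly_eval_circle (t : ℂ) (ht : ‖t‖ = 1) :
    eval ![√2 * t.re, √2 * t.im, 1] conePoly = 0 := by
  have h2 : √2 ^ 2 = 2 := Real.sq_sqrt (by norm_num)
  have h1 : t.re ^ 2 + t.im ^ 2 = 1 := by
    rw [← one_pow 2, ← ht, Complex.sq_norm, Complex.normSq_apply]; ring
  simp only [conePoly, map_sub, map_add, map_mul, map_pow, eval_X, Matrix.cons_val_zero,
    Matrix.cons_val_one, Matrix.cons_val, map_ofNat, mul_pow, h2]
  linear_combination 2 * h1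

/-- A nonzero homogeneous harmonic polynomial that vanishes on the cone gives rise to an associated
Legendre function of the same degree that vanishes on the cone. -/
theorem exists_coneValue_eq_zero {h : MvPolynomial (Fin 3) ℝ} {n : ℕ} (h0 : h ≠ 0)
    (hn : h.IsHomogeneous n) (hl : lapl h = 0)
    (hz : ∀ v : Space, polyFun conePoly v = 0 → polyFun h v = 0) :
    ∃ m j, m + j = n ∧ coneValue m j = 0 := by
  by_contra! hA
  refine h0 (toComplex_injective ?_)
  rw [map_zero]
  have hcirc : ∀ t : ℂ, ‖t‖ = 1 →
      eval ![(√2 : ℝ) * t, (√2 : ℝ) * t⁻¹, 1] (toComplex h) = 0 := fun t ht => by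
    have hp := conePoly_eval_circle t ht
    have e := eval_toComplex h (√2 * t.re) (√2 * t.im) 1
    have e0 : eval ![√2 * t.re, √2 * t.im, 1] h = 0 := by
      have := hz (WithLp.toLp 2 ![√2 * t.re, √2 * t.im, 1])
      simp only [polyFun] at this
      exact this hp
    rw [e0] at e
    have hinv : t⁻¹ = (t.re : ℂ) - t.im * I := by
      rw [Complex.inv_def, Complex.normSq_eq_norm_sq, ht]
      apply Complex.ext <;> simp
    rw [hinv]
    have hre := Complex.re_add_im t
    rw [← Complex.ofReal_zero, ← e]
    congr 2
    ext i
    fin_cases i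
    · simp; linear_combination -(√2 : ℂ) * hre
    · simp; ring
    · simp
  have hhom := toComplex_isHomogeneous hn
  have hlap := laplace_toComplex hl
  ext d
  rw [coeff_zero]
  rcases le_total (d 1) (d 0) with hd | hd
  · exact coeff_eq_zero_of_vanishing hhom hlap hcirc hA hd
  -- Negative modes reduce to positive ones by exchanging w and w': the equation is symmetric, and
  -- on the circle t is replaced by t⁻¹.
  · let e : Fin 3 ≃ Fin 3 := Equiv.swap 0 1
    have e0 : e 0 = 1 := rfl
    have e1 : e 1 = 0 := rfl
    have e2 : e 2 = 2 := rfl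
    have := coeff_eq_zero_of_vanishing (H := rename e (toComplex h)) (n := n)
      (hhom.rename_isHomogeneous) ?_ ?_ hA (d := d.mapDomain e) ?_
    · rwa [coeff_rename_mapDomain _ e.injective] at this
    · have := congrArg (rename e) hlap
      rw [map_add, map_mul, map_ofNat, map_zero] at this
      simp only [← pderiv_rename e.injective, e0, e1, e2] at this
      rwa [pderiv_comm]
    · intro t ht
      rw [eval_rename]
      have := hcirc t⁻¹ (by rw [norm_inv, ht, inv_one])
      rw [inv_inv] at this
      rw [← this]
      congr 2
      ext i
      fin_cases i <;> rfl
    · rw [← e0]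
      conv_rhs => rw [← e1]
      rw [Finsupp.mapDomain_apply e.injective, Finsupp.mapDomain_apply e.injective]
      exact hd

end HarmonicCone

/-! ### Green's identity and the regularized Newtonian kernel -/

namespace HarmonicCone

open MeasureTheory InnerProductSpace
open scoped Laplacian Topology ContDiff

lemma continuous_laplacian {g : Space → ℝ} (hg : ContDiff ℝ 2 g) : Continuous (Δ g) := by
  rw [laplacian_eq_iteratedFDeriv_orthonormalBasis g (EuclideanSpace.basisFun (Fin 3) ℝ)]
  have := hg.continuous_iteratedFDeriv (m := 2) le_rfl
  exact continuous_finsetSum _ fun i _ => by fun_prop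

lemma contDiff_fderiv_single {g : Space → ℝ} {n m : WithTop ℕ∞} (hg : ContDiff ℝ n g)
    (h : m + 1 ≤ n) (v : Space) : ContDiff ℝ m fun y => fderiv ℝ g y v :=
  (hg.fderiv_right h).clm_apply contDiff_const

lemma integral_mul_fderiv_eq {Ψ g : Space → ℝ} (hΨ : ContDiff ℝ 1 Ψ) (hg : ContDiff ℝ 1 g)
    (hs : HasCompactSupport g) (v : Space) :
    ∫ y, Ψ y * fderiv ℝ g y v = - ∫ y, fderiv ℝ Ψ y v * g y := by
  have hΨ' := (contDiff_fderiv_single (m := 0) hΨ (by simp) v).continuous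
  have hg' := (contDiff_fderiv_single (m := 0) hg (by simp) v).continuous
  have hs' : HasCompactSupport fun y => fderiv ℝ g y v :=
    (hs.fderiv ℝ).comp_left (g := fun L : Space →L[ℝ] ℝ => L v) rfl
  refine integral_mul_fderiv_eq_neg_fderiv_mul_of_integrable ?_ ?_ ?_
    (fun y _ => hΨ.differentiable one_ne_zero y) (fun y _ => hg.differentiable one_ne_zero y)
  · exact (hΨ'.mul hg.continuous).integrable_of_hasCompactSupport hs.mul_left
  · exact (hΨ.continuous.mul hg').integrable_of_hasCompactSupport hs'.mul_left
  · exact (hΨ.continuous.mul hg.continuous).integrable_of_hasCompactSupport hs.mul_left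

/-- Green's second identity for a function of compact support. -/
lemma integral_mul_laplacian {Ψ g : Space → ℝ} (hΨ : ContDiff ℝ 2 Ψ) (hg : ContDiff ℝ 2 g)
    (hs : HasCompactSupport g) : ∫ y, Ψ y * Δ g y = ∫ y, Δ Ψ y * g y := by
  have hΨ1 : ContDiff ℝ 1 Ψ := hΨ.of_le (by norm_num)
  have hg' := fun v => contDiff_fderiv_single (m := 1) hg (by norm_num) v
  have hΨ' := fun v => contDiff_fderiv_single (m := 1) hΨ (by norm_num) v
  have hs' : ∀ v, HasCompactSupport fun y => fderiv ℝ g y v := fun v =>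
    (hs.fderiv ℝ).comp_left (g := fun L : Space →L[ℝ] ℝ => L v) rfl
  simp_rw [laplacian_eq_sum_fderiv hg.contDiffAt, laplacian_eq_sum_fderiv hΨ.contDiffAt,
    Finset.mul_sum, Finset.sum_mul]
  rw [integral_finsetSum, integral_finsetSum]
  · refine Finset.sum_congr rfl fun i _ => ?_
    rw [integral_mul_fderiv_eq hΨ1 (hg' _) (hs' _), integral_mul_fderiv_eq (hΨ' _)
      (hg.of_le (by norm_num)) hs, neg_neg]
  · intro i _
    have := (contDiff_fderiv_single (m := 0) (hΨ' (EuclideanSpace.single i 1)) (by simp)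
      (EuclideanSpace.single i 1)).continuous
    exact (this.mul hg.continuous).integrable_of_hasCompactSupport hs.mul_left
  · intro i _
    have := (contDiff_fderiv_single (m := 0) (hg' (EuclideanSpace.single i 1)) (by simp)
      (EuclideanSpace.single i 1)).continuous
    refine (hΨ.continuous.mul this).integrable_of_hasCompactSupport (HasCompactSupport.mul_left ?_)
    exact ((hs' _).fderiv ℝ).comp_left
      (g := fun L : Space →L[ℝ] ℝ => L (EuclideanSpace.single i 1)) rfl

lemma fderiv_rpow_norm_sq (x : Space) {ε : ℝ} (hε : 0 < ε) (s : ℝ) (y v : Space) :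
    fderiv ℝ (fun y => (‖y - x‖ ^ 2 + ε ^ 2) ^ s) y v =
      2 * s * inner ℝ (y - x) v * (‖y - x‖ ^ 2 + ε ^ 2) ^ (s - 1) := by
  have h1 : HasFDerivAt (fun y : Space => ‖y - x‖ ^ 2 + ε ^ 2) _ y :=
    (((hasFDerivAt_id y).sub_const x).norm_sq).add_const (ε ^ 2)
  have h2 := h1.rpow_const (p := s) (Or.inl (by positivity))
  rw [h2.fderiv]
  simp [inner_sub_left]
  ring

lemma contDiff_rpow_norm_sq (x : Space) {ε : ℝ} (hε : 0 < ε) (s : ℝ) {n : WithTop ℕ∞} :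
    ContDiff ℝ n (fun y : Space => (‖y - x‖ ^ 2 + ε ^ 2) ^ s) := by
  refine ContDiff.rpow_const_of_ne ?_ fun y => by positivity
  exact ((contDiff_id.sub contDiff_const).norm_sq ℝ).add contDiff_const

/-- The Laplacian of the regularized Newtonian kernel. -/
lemma laplacian_regularized_kernel (x : Space) {ε : ℝ} (hε : 0 < ε) (y : Space) :
    Δ (fun y => (‖y - x‖ ^ 2 + ε ^ 2) ^ (-1 / 2 : ℝ)) y =
      -(3 * ε ^ 2 * (‖y - x‖ ^ 2 + ε ^ 2) ^ (-5 / 2 : ℝ)) := by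
  rw [laplacian_eq_sum_fderiv (contDiff_rpow_norm_sq x hε _).contDiffAt]
  have hq : 0 < ‖y - x‖ ^ 2 + ε ^ 2 := by positivity
  -- With q = ‖y - x‖² + ε², summing 3(y i - x i)² - q over i gives 3‖y - x‖² - 3q = -3ε².
  have key : ∀ i : Fin 3, fderiv ℝ (fun y => fderiv ℝ
      (fun y => (‖y - x‖ ^ 2 + ε ^ 2) ^ (-1 / 2 : ℝ)) y (EuclideanSpace.single i 1)) y
      (EuclideanSpace.single i 1) = (3 * (y i - x i) ^ 2 - (‖y - x‖ ^ 2 + ε ^ 2)) *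
        (‖y - x‖ ^ 2 + ε ^ 2) ^ (-5 / 2 : ℝ) := by
    intro i
    have e : (fun y => fderiv ℝ
        (fun y => (‖y - x‖ ^ 2 + ε ^ 2) ^ (-1 / 2 : ℝ)) y (EuclideanSpace.single i 1)) =
        fun y => -((y i - x i) * (‖y - x‖ ^ 2 + ε ^ 2) ^ (-3 / 2 : ℝ)) := by
      ext y
      rw [fderiv_rpow_norm_sq x hε]
      simp [EuclideanSpace.inner_single_right]
      norm_num
      ring
    have h1 : HasFDerivAt (fun y : Space => y i - x i)
        (EuclideanSpace.proj i : Space →L[ℝ] ℝ) y :=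
      (EuclideanSpace.proj i : Space →L[ℝ] ℝ).hasFDerivAt.sub_const _
    have h2 : HasFDerivAt (fun y : Space => (‖y - x‖ ^ 2 + ε ^ 2) ^ (-3 / 2 : ℝ)) _ y :=
      ((contDiff_rpow_norm_sq (n := 1) x hε (-3 / 2)).differentiable one_ne_zero y).hasFDerivAt
    have h3 : HasFDerivAt
        (fun y : Space => -((y i - x i) * (‖y - x‖ ^ 2 + ε ^ 2) ^ (-3 / 2 : ℝ))) _ y :=
      (h1.mul h2).neg
    rw [e, h3.fderiv]
    have e3 : (‖y - x‖ ^ 2 + ε ^ 2) ^ (-3 / 2 : ℝ) =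
        (‖y - x‖ ^ 2 + ε ^ 2) * (‖y - x‖ ^ 2 + ε ^ 2) ^ (-5 / 2 : ℝ) := by
      rw [← Real.rpow_one_add' hq.le (by norm_num)]; norm_num
    simp [fderiv_rpow_norm_sq x hε, EuclideanSpace.inner_single_right, e3]
    norm_num
    ring
  simp_rw [key, Fin.sum_univ_three]
  have hn : ‖y - x‖ ^ 2 = (y 0 - x 0) ^ 2 + (y 1 - x 1) ^ 2 + (y 2 - x 2) ^ 2 := by
    rw [EuclideanSpace.real_norm_sq_eq, Fin.sum_univ_three]; rfl
  linear_combination (-3 * (‖y - x‖ ^ 2 + ε ^ 2) ^ (-5 / 2 : ℝ)) * hn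

end HarmonicCone

/-! ### Representation by a Newtonian potential -/

namespace HarmonicCone

open MeasureTheory InnerProductSpace Filter
open scoped Laplacian Topology ContDiff

lemma integrable_kernel : Integrable fun η : Space => 3 * (1 + ‖η‖ ^ 2) ^ (-5 / 2 : ℝ) := by
  have := integrable_rpow_neg_one_add_norm_sq (E := Space) (μ := volume) (r := 5)
    (by rw [finrank_euclideanSpace_fin]; norm_num)
  exact (this.const_mul 3)

lemma integral_kernel_pos : 0 < ∫ η : Space, 3 * (1 + ‖η‖ ^ 2) ^ (-5 / 2 : ℝ) := by
  rw [integral_pos_iff_support_of_nonneg (fun η => by positivity) integrable_kernel]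
  have : Function.support (fun η : Space => 3 * (1 + ‖η‖ ^ 2) ^ (-5 / 2 : ℝ)) = Set.univ :=
    Set.eq_univ_of_forall fun η => (by positivity : 3 * (1 + ‖η‖ ^ 2) ^ (-5 / 2 : ℝ) ≠ 0)
  rw [this]
  exact isOpen_univ.measure_pos _ Set.univ_nonempty

/-- The substitution y = x + εη exhibits the kernel as an approximate identity of fixed mass. The
mass is never computed; its positivity suffices. -/
lemma integral_kernel_scale (g : Space → ℝ) (x : Space) {ε : ℝ} (hε : 0 < ε) :
    ∫ y, 3 * ε ^ 2 * (‖y - x‖ ^ 2 + ε ^ 2) ^ (-5 / 2 : ℝ) * g y =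
      ∫ η : Space, 3 * (1 + ‖η‖ ^ 2) ^ (-5 / 2 : ℝ) * g (x + ε • η) := by
  rw [← integral_add_left_eq_self _ x]
  have h := Measure.integral_comp_smul (volume : Measure Space)
    (fun y => 3 * ε ^ 2 * (‖x + y - x‖ ^ 2 + ε ^ 2) ^ (-5 / 2 : ℝ) * g (x + y)) ε
  rw [finrank_euclideanSpace_fin, abs_of_pos (by positivity), smul_eq_mul, inv_mul_eq_div,
    eq_div_iff (by positivity), mul_comm, ← integral_const_mul] at h
  rw [← h]
  refine integral_congr_ae (Eventually.of_forall fun η => ?_)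
  have e : ‖x + ε • η - x‖ ^ 2 + ε ^ 2 = ε ^ 2 * (1 + ‖η‖ ^ 2) := by
    rw [add_sub_cancel_left, norm_smul, Real.norm_eq_abs, mul_pow, sq_abs]; ring
  have e2 : (ε ^ 2) ^ (-5 / 2 : ℝ) * ε ^ 5 = 1 := by
    rw [← Real.rpow_natCast ε 2, ← Real.rpow_mul hε.le, ← Real.rpow_natCast ε 5,
      ← Real.rpow_add hε]
    norm_num
  simp only [e]
  rw [Real.mul_rpow (by positivity) (by positivity)]
  linear_combination (3 * (1 + ‖η‖ ^ 2) ^ (-5 / 2 : ℝ) * g (x + ε • η)) * e2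

/-- The Newtonian potential of the Laplacian of a function of compact support, at a point near which
the function is harmonic. -/
theorem newton_potential_laplacian {g : Space → ℝ} (hg : ContDiff ℝ 2 g) (hs : HasCompactSupport g)
    {x : Space} (hx : x ∉ tsupport (Δ g)) :
    (∫ η : Space, 3 * (1 + ‖η‖ ^ 2) ^ (-5 / 2 : ℝ)) * g x =
      -∫ y, (‖y - x‖ ^ 2) ^ (-1 / 2 : ℝ) * Δ g y := by
  obtain ⟨M, hM⟩ := hg.continuous.bounded_above_of_compact_support hs
  have hΔc := continuous_laplacian hg
  have hΔs : HasCompactSupport (Δ g) := by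
    refine HasCompactSupport.intro hs fun y hy => ?_
    have : g =ᶠ[𝓝 y] fun _ => 0 := notMem_tsupport_iff_eventuallyEq.1 hy
    rw [(laplacian_congr_nhds this).self_of_nhds]
    simp
  obtain ⟨ρ, hρ, hball⟩ := Metric.isOpen_iff.1 (isClosed_tsupport (Δ g)).isOpen_compl x hx
  have hzero : ∀ y, ‖y - x‖ < ρ → Δ g y = 0 := fun y hy =>
    image_eq_zero_of_notMem_tsupport (hball (by rwa [Metric.mem_ball, dist_eq_norm]))
  have h1 : Tendsto (fun ε : ℝ => ∫ η : Space, 3 * (1 + ‖η‖ ^ 2) ^ (-5 / 2 : ℝ) * g (x + ε • η))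
      (𝓝[>] 0) (𝓝 ((∫ η : Space, 3 * (1 + ‖η‖ ^ 2) ^ (-5 / 2 : ℝ)) * g x)) := by
    rw [← integral_mul_const]
    refine tendsto_integral_filter_of_dominated_convergence
      (fun η : Space => 3 * (1 + ‖η‖ ^ 2) ^ (-5 / 2 : ℝ) * M) ?_ ?_
      (integrable_kernel.mul_const M) ?_
    · refine Eventually.of_forall fun ε => ?_
      refine integrable_kernel.aestronglyMeasurable.mul ?_
      exact (hg.continuous.comp (by fun_prop)).aestronglyMeasurable
    · refine Eventually.of_forall fun ε => Eventually.of_forall fun η => ?_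
      rw [norm_mul, Real.norm_of_nonneg (by positivity)]
      gcongr
      exact hM _
    · refine Eventually.of_forall fun η => ?_
      refine Tendsto.mono_left ?_ nhdsWithin_le_nhds
      have : Continuous fun ε : ℝ => 3 * (1 + ‖η‖ ^ 2) ^ (-5 / 2 : ℝ) * g (x + ε • η) :=
        continuous_const.mul (hg.continuous.comp (by fun_prop))
      simpa using this.tendsto 0
  -- Since Δ g vanishes within ρ of x, the singularity of the kernel is never met and ρ⁻¹ ‖Δ g‖
  -- dominates.
  have h2 : Tendsto (fun ε : ℝ => ∫ y, (‖y - x‖ ^ 2 + ε ^ 2) ^ (-1 / 2 : ℝ) * Δ g y)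
      (𝓝[>] 0) (𝓝 (∫ y, (‖y - x‖ ^ 2) ^ (-1 / 2 : ℝ) * Δ g y)) := by
    refine tendsto_integral_filter_of_dominated_convergence
      (fun y => (ρ ^ 2) ^ (-1 / 2 : ℝ) * ‖Δ g y‖) ?_ ?_
      ((hΔc.integrable_of_hasCompactSupport hΔs).norm.const_mul _) ?_
    · filter_upwards [self_mem_nhdsWithin] with ε hε
      exact ((contDiff_rpow_norm_sq (n := 0) x hε (-1 / 2)).continuous.mul
        hΔc).aestronglyMeasurable
    · refine Eventually.of_forall fun ε => Eventually.of_forall fun y => ?_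
      rw [norm_mul, Real.norm_of_nonneg (by positivity)]
      rcases lt_or_ge ‖y - x‖ ρ with hy | hy
      · simp [hzero y hy]
      · gcongr ?_ * _
        refine Real.rpow_le_rpow_of_nonpos (by positivity) ?_ (by norm_num)
        nlinarith [sq_nonneg ε]
    · refine Eventually.of_forall fun y => ?_
      refine Tendsto.mono_left ?_ nhdsWithin_le_nhds
      rcases lt_or_ge ‖y - x‖ ρ with hy | hy
      · simp [hzero y hy]
      · have : ContinuousAt (fun ε : ℝ => (‖y - x‖ ^ 2 + ε ^ 2) ^ (-1 / 2 : ℝ) * Δ g y) 0 := by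
          refine ContinuousAt.mul (ContinuousAt.rpow_const (by fun_prop) (Or.inl ?_))
            continuousAt_const
          have : 0 < ‖y - x‖ := hρ.trans_le hy
          positivity
        simpa using this.tendsto
  refine tendsto_nhds_unique (h1.congr' ?_) h2.neg
  filter_upwards [self_mem_nhdsWithin] with ε hε
  rw [integral_mul_laplacian (contDiff_rpow_norm_sq x hε _) hg hs, ← integral_kernel_scale g x hε,
    ← integral_neg]
  refine integral_congr_ae (Eventually.of_forall fun y => ?_)
  simp only [laplacian_regularized_kernel x hε]
  ring

end HarmonicCone

/-! ### Analyticity of harmonic functions -/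

namespace HarmonicCone

open MeasureTheory InnerProductSpace Filter
open scoped Laplacian Topology ContDiff ENNReal NNReal

section BinomialSeries

variable {K : Type*} [TopologicalSpace K] [CompactSpace K]

/-- The terms are bounded in norm by those of the real binomial series, whose radius is at least 1;
any radius below 1 would serve. -/
lemma half_le_binomialSeries_radius (a : ℝ) :
    ((1 / 2 : ℝ≥0) : ℝ≥0∞) ≤ (binomialSeries C(K, ℝ) a).radius := by
  have hR : ((1 / 2 : ℝ≥0) : ℝ≥0∞) < (binomialSeries ℝ a).radius := by
    refine lt_of_lt_of_le ?_ binomialSeries_radius_ge_one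
    exact_mod_cast (by norm_num : (1 / 2 : ℝ≥0) < 1)
  have h := ((binomialSeries ℝ a).summable_norm_mul_pow hR).tendsto_atTop_zero
  refine FormalMultilinearSeries.le_radius_of_eventually_le _ 1 ?_
  filter_upwards [h.eventually_le_const zero_lt_one, eventually_gt_atTop 0] with n hn hn0
  refine le_trans ?_ hn
  gcongr
  exact (FormalMultilinearSeries.ofScalars_norm_le _ _ _ hn0).trans_eq
    (FormalMultilinearSeries.ofScalars_norm (E := ℝ) _ _).symm

lemma analyticAt_binomialSeries_sum (a : ℝ) :
    AnalyticAt ℝ (binomialSeries C(K, ℝ) a).sum 0 := by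
  refine ((binomialSeries C(K, ℝ) a).hasFPowerSeriesOnBall ?_).analyticAt
  exact lt_of_lt_of_le (by norm_num) (half_le_binomialSeries_radius a)

lemma binomialSeries_sum_apply (a : ℝ) {h : C(K, ℝ)} (hh : ‖h‖ < 1 / 2) (y : K) :
    (binomialSeries C(K, ℝ) a).sum h y = (1 + h y) ^ a := by
  have hA : HasSum (fun n => binomialSeries C(K, ℝ) a n fun _ => h)
      ((binomialSeries C(K, ℝ) a).sum h) := by
    refine FormalMultilinearSeries.hasSum _ ?_
    rw [Metric.mem_eball, edist_zero_right]
    refine lt_of_lt_of_le ?_ (half_le_binomialSeries_radius a)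
    rw [← ofReal_norm, ENNReal.ofReal_lt_coe_iff (norm_nonneg _)]
    simpa using hh
  have h1 := hA.mapL (ContinuousMap.evalCLM ℝ y)
  have hy : |h y| < 1 := lt_of_le_of_lt (h.norm_coe_le_norm y) (by linarith)
  have h2 := (Real.one_add_rpow_hasFPowerSeriesOnBall_zero (a := a)).hasSum (y := h y)
    (by rw [Metric.mem_eball, edist_zero_right, ← ofReal_norm]
        simpa using hy)
  rw [zero_add] at h2
  have e : (fun n => ContinuousMap.evalCLM ℝ y (binomialSeries C(K, ℝ) a n fun _ => h)) =
      fun n => binomialSeries ℝ a n fun _ => h y := by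
    ext n
    rw [binomialSeries_apply, binomialSeries_apply]
    simp
  rw [e] at h1
  exact h1.unique h2

end BinomialSeries

/-- The Newtonian potential is analytic off the support of the density. -/
lemma analyticAt_newton_potential {f : Space → ℝ} (hf : Continuous f) (hs : HasCompactSupport f)
    {c : Space} (hc : c ∉ tsupport f) :
    AnalyticAt ℝ (fun x => ∫ y, (‖y - x‖ ^ 2) ^ (-1 / 2 : ℝ) * f y) c := by
  set K := tsupport f
  have : CompactSpace K := isCompact_iff_compactSpace.1 hs
  have hpos : ∀ y : K, 0 < ‖(y : Space) - c‖ ^ 2 := fun y => by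
    have : (y : Space) - c ≠ 0 := fun h => hc (by rw [← sub_eq_zero.1 h]; exact y.2)
    positivity
  -- As a map into the Banach algebra C(K, ℝ), G is polynomial in x. Normalized by its value at c it
  -- is 1 + H with H c = 0, so its power -1/2 is a binomial series in H; integration against F is a
  -- continuous linear functional.
  let G : Space → C(K, ℝ) := fun x => ⟨fun y => ‖(y : Space) - x‖ ^ 2, by fun_prop⟩
  have hG : AnalyticAt ℝ G c := by
    have e : G = fun x => G 0 + ∑ i : Fin 3, ((x i) ^ 2 • (1 : C(K, ℝ)) -
        (2 * x i) • (⟨fun y => (y : Space) i, by fun_prop⟩ : C(K, ℝ))) := by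
      ext x y
      simp [G, EuclideanSpace.real_norm_sq_eq, Fin.sum_univ_three]
      ring
    have hx : ∀ i : Fin 3, AnalyticAt ℝ (fun x : Space => x i) c := fun i =>
      (EuclideanSpace.proj i : Space →L[ℝ] ℝ).analyticAt c
    rw [e]
    refine analyticAt_const.add (Finset.analyticAt_fun_sum _ fun i _ => ?_)
    exact (((hx i).pow 2).smul analyticAt_const).sub
      ((analyticAt_const.mul (hx i)).smul analyticAt_const)
  let w : C(K, ℝ) := ⟨fun y => (‖(y : Space) - c‖ ^ 2)⁻¹,
    Continuous.inv₀ (by fun_prop) fun y => (hpos y).ne'⟩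
  let H : Space → C(K, ℝ) := fun x => w * G x - 1
  have hH : AnalyticAt ℝ H c := (analyticAt_const.mul hG).sub analyticAt_const
  have hHc : H c = 0 := by
    ext y
    have := hpos y
    simp [H, w, G, this.ne']
  let F : C(K, ℝ) := ⟨fun y => (‖(y : Space) - c‖ ^ 2) ^ (-1 / 2 : ℝ) * f y,
    (Continuous.rpow_const (by fun_prop) fun y => Or.inl (hpos y).ne').mul
      (hf.comp continuous_subtype_val)⟩
  let ν : Measure K := Measure.comap Subtype.val volume
  have : IsFiniteMeasure ν := ⟨by
    rw [Measure.comap_apply _ Subtype.val_injective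
      (fun s hs => (MeasurableEmbedding.subtype_coe
        (isClosed_tsupport f).measurableSet).measurableSet_image.2 hs) _ MeasurableSet.univ]
    simpa using IsCompact.measure_lt_top hs⟩
  have hint : ∀ g : C(K, ℝ), Integrable g ν := fun g =>
    g.continuous.integrable_of_hasCompactSupport (HasCompactSupport.of_compactSpace g)
  let Λ : C(K, ℝ) →L[ℝ] ℝ := LinearMap.mkContinuous
    { toFun := fun g => ∫ y, (g * F) y ∂ν
      map_add' := fun g g' => by
        rw [← integral_add (hint _) (hint _)]
        simp [add_mul]
      map_smul' := fun a g => by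
        rw [RingHom.id_apply, smul_eq_mul, ← integral_const_mul]
        simp } (∫ y, ‖F y‖ ∂ν) fun g => by
      rw [mul_comm, ← integral_const_mul]
      refine norm_integral_le_of_norm_le ((hint F).norm.const_mul _) (Eventually.of_forall fun y => ?_)
      rw [ContinuousMap.mul_apply, norm_mul]
      gcongr
      exact g.norm_coe_le_norm y
  have hS : AnalyticAt ℝ (fun x => (binomialSeries C(K, ℝ) (-1 / 2 : ℝ)).sum (H x)) c :=
    AnalyticAt.comp (g := (binomialSeries C(K, ℝ) (-1 / 2 : ℝ)).sum) (f := H)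
      (by rw [hHc]; exact analyticAt_binomialSeries_sum _) hH
  refine ((Λ.analyticAt _).comp hS).congr ?_
  have hsmall : ∀ᶠ x in 𝓝 c, ‖H x‖ < 1 / 2 := by
    have := hH.continuousAt.norm
    rw [ContinuousAt, hHc, norm_zero] at this
    exact this.eventually_lt_const (by norm_num)
  filter_upwards [hsmall] with x hx
  have e1 : ∫ y, (‖y - x‖ ^ 2) ^ (-1 / 2 : ℝ) * f y =
      ∫ y in K, (‖y - x‖ ^ 2) ^ (-1 / 2 : ℝ) * f y := by
    refine (setIntegral_eq_integral_of_forall_compl_eq_zero fun y hy => ?_).symm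
    rw [image_eq_zero_of_notMem_tsupport hy, mul_zero]
  rw [e1, ← integral_subtype_comap (isClosed_tsupport f).measurableSet]
  refine integral_congr_ae (Eventually.of_forall fun y => ?_)
  have h1 : (1 + H x y) = w y * G x y := by simp [H]
  have h2 : ‖(y : Space) - x‖ ^ 2 = ‖(y : Space) - c‖ ^ 2 * (w y * G x y) := by
    exact (mul_inv_cancel_left₀ (hpos y).ne' _).symm
  simp only [ContinuousMap.mul_apply, binomialSeries_sum_apply _ hx y, h1]
  have h3 : 0 ≤ w y * G x y := mul_nonneg (inv_nonneg.2 (hpos y).le) (sq_nonneg _)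
  rw [h2, Real.mul_rpow (hpos y).le h3]
  simp only [F, ContinuousMap.coe_mk]
  ring

/-- Harmonic functions are real analytic. -/
theorem analyticAt_of_harmonicAt {u : Space → ℝ} {c : Space} (hu : HarmonicAt u c) :
    AnalyticAt ℝ u c := by
  obtain ⟨r, hr, hball⟩ := Metric.eventually_nhds_iff_ball.1 hu.eventually
  -- The cut-off χ is 1 on the ball of radius r/3, where Δ (χ u) therefore vanishes, and its support
  -- stays inside the ball where u is harmonic.
  let χ : ContDiffBump c := ⟨r / 3, r / 2, by positivity, by linarith⟩
  let g : Space → ℝ := fun y => χ y * u y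
  have hs : HasCompactSupport g := χ.hasCompactSupport.mul_right
  have hg : ContDiff ℝ 2 g := by
    refine contDiff_iff_contDiffAt.2 fun y => ?_
    by_cases hy : y ∈ Metric.ball c r
    · exact χ.contDiffAt.mul (hball y hy).1
    · have hy' : y ∉ tsupport χ := by
        rw [χ.tsupport_eq]
        intro h
        rw [Metric.mem_closedBall] at h
        exact hy (Metric.mem_ball.2 (lt_of_le_of_lt h (by change r / 2 < r; linarith)))
      have : g =ᶠ[𝓝 y] fun _ => 0 := by
        filter_upwards [notMem_tsupport_iff_eventuallyEq.1 hy'] with z hz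
        simp [g, hz]
      exact contDiffAt_const.congr_of_eventuallyEq this
  have hgu : ∀ x ∈ Metric.ball c (r / 3), g =ᶠ[𝓝 x] u := fun x hx => by
    filter_upwards [Metric.isOpen_ball.mem_nhds hx] with z hz
    have : χ z = 1 := χ.one_of_mem_closedBall (Metric.ball_subset_closedBall hz)
    simp [g, this]
  have hΔ0 : ∀ x ∈ Metric.ball c (r / 3), x ∉ tsupport (Δ g) := fun x hx => by
    rw [notMem_tsupport_iff_eventuallyEq]
    refine (laplacian_congr_nhds (hgu x hx)).trans (hball x ?_).2
    exact Metric.ball_subset_ball (by linarith) hx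
  have hΔs : HasCompactSupport (Δ g) := by
    refine HasCompactSupport.intro hs fun y hy => ?_
    have : g =ᶠ[𝓝 y] fun _ => 0 := notMem_tsupport_iff_eventuallyEq.1 hy
    rw [(laplacian_congr_nhds this).self_of_nhds]
    simp
  have hcc : c ∈ Metric.ball c (r / 3) := Metric.mem_ball_self (by positivity)
  have hA := (analyticAt_newton_potential (continuous_laplacian hg) hΔs (hΔ0 c hcc)).neg
  have hA' := analyticAt_const (𝕜 := ℝ)
    (v := (∫ η : Space, 3 * (1 + ‖η‖ ^ 2) ^ (-5 / 2 : ℝ))⁻¹) (x := c) |>.mul hA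
  refine hA'.congr ?_
  filter_upwards [Metric.isOpen_ball.mem_nhds hcc] with x hx
  rw [← (hgu x hx).self_of_nhds, Pi.mul_apply, Pi.neg_apply,
    ← newton_potential_laplacian hg hs (hΔ0 x hx),
    inv_mul_cancel_left₀ integral_kernel_pos.ne']

end HarmonicCone

/-! ### Taylor polynomials of harmonic functions vanishing on the cone -/

namespace HarmonicCone

open MvPolynomial InnerProductSpace Filter Asymptotics
open scoped Laplacian Topology ContDiff ENNReal

/-- The homogeneous polynomial given by a term of a power series. -/
noncomputable def termPoly (p : FormalMultilinearSeries ℝ Space ℝ) (k : ℕ) :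
    MvPolynomial (Fin 3) ℝ :=
  ∑ r : Fin k → Fin 3, C (p k fun i => EuclideanSpace.single (r i) 1) * ∏ i, X (r i)

lemma polyFun_termPoly (p : FormalMultilinearSeries ℝ Space ℝ) (k : ℕ) (y : Space) :
    polyFun (termPoly p k) y = p k fun _ => y := by
  have hy : y = ∑ j, y j • (EuclideanSpace.single j 1 : Space) := by
    ext i; simp [Fin.sum_univ_three]; fin_cases i <;> simp
  conv_rhs => rw [hy]
  rw [ContinuousMultilinearMap.map_sum]
  simp only [termPoly, polyFun, map_sum, map_mul, eval_C, map_prod, eval_X]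
  refine Finset.sum_congr rfl fun r _ => ?_
  rw [ContinuousMultilinearMap.map_smul_univ, smul_eq_mul, mul_comm]

lemma termPoly_isHomogeneous (p : FormalMultilinearSeries ℝ Space ℝ) (k : ℕ) :
    (termPoly p k).IsHomogeneous k := by
  refine IsHomogeneous.sum _ _ _ fun r _ => IsHomogeneous.C_mul ?_ _
  simpa using IsHomogeneous.prod Finset.univ (fun i => X (r i) : Fin k → MvPolynomial (Fin 3) ℝ)
    (fun _ => 1) fun i _ => isHomogeneous_X _ _

/-- The polynomial given by the first `n` terms of a power series. -/
noncomputable def partialSumPoly (p : FormalMultilinearSeries ℝ Space ℝ) (n : ℕ) :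
    MvPolynomial (Fin 3) ℝ :=
  ∑ k ∈ Finset.range n, termPoly p k

lemma polyFun_partialSumPoly (p : FormalMultilinearSeries ℝ Space ℝ) (n : ℕ) (y : Space) :
    polyFun (partialSumPoly p n) y = p.partialSum n y := by
  simp only [FormalMultilinearSeries.partialSum, ← polyFun_termPoly]
  simp [partialSumPoly, polyFun]

lemma homogeneousComponent_partialSumPoly (p : FormalMultilinearSeries ℝ Space ℝ) (n k : ℕ) :
    homogeneousComponent k (partialSumPoly p n) = if k < n then termPoly p k else 0 := by
  simp only [partialSumPoly, map_sum, homogeneousComponent_of_mem (termPoly_isHomogeneous p _)]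
  simp

/-- The constant term is the limit at 0, hence zero; dividing by X lowers both the degree bound and
the order. -/
lemma polynomial_eq_zero_of_isBigO (n : ℕ) (P : Polynomial ℝ) (hd : P.degree < n)
    (h : (fun t => P.eval t) =O[𝓝[≠] 0] fun t => t ^ n) : P = 0 := by
  induction n generalizing P with
  | zero => simpa [Polynomial.degree_lt_iff_coeff_zero, Polynomial.ext_iff] using hd
  | succ n ih =>
    have h0 : P.coeff 0 = 0 := by
      rw [Polynomial.coeff_zero_eq_eval_zero]
      have h1 : Tendsto (fun t => P.eval t) (𝓝[≠] 0) (𝓝 (P.eval 0)) :=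
        (P.continuous.tendsto 0).mono_left nhdsWithin_le_nhds
      have h2 : Tendsto (fun t : ℝ => t ^ (n + 1)) (𝓝[≠] 0) (𝓝 0) := by
        have := ((continuous_pow (n + 1)).tendsto (0 : ℝ)).mono_left
          (nhdsWithin_le_nhds (s := {0}ᶜ))
        simpa using this
      exact tendsto_nhds_unique h1 (h.trans_tendsto h2)
    have hP : Polynomial.X * P.divX = P := by
      conv_rhs => rw [← Polynomial.X_mul_divX_add P, h0, map_zero, add_zero]
    have hd' : P.divX.degree < n := by
      rw [Polynomial.degree_lt_iff_coeff_zero] at hd ⊢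
      intro m hm
      rw [Polynomial.coeff_divX]
      exact hd _ (by omega)
    rw [← hP, ih P.divX hd' ?_, mul_zero]
    have h1 := h.mul (isBigO_refl (fun t : ℝ => t⁻¹) (𝓝[≠] 0))
    refine (h1.congr' ?_ ?_)
    · filter_upwards [self_mem_nhdsWithin] with t ht
      have ht : t ≠ 0 := ht
      conv_lhs => rw [← hP]
      rw [Polynomial.eval_mul, Polynomial.eval_X]
      field_simp
    · filter_upwards [self_mem_nhdsWithin] with t ht
      rw [pow_succ, mul_inv_cancel_right₀ ht]

/-- A polynomial of degree less than `n` that is `O(‖y‖ ^ n)` along a line vanishes there. -/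
lemma polyFun_eq_zero_of_isBigO {q : MvPolynomial (Fin 3) ℝ} {n : ℕ} {v : Space}
    (hq : ∀ k ≥ n, homogeneousComponent k q = 0)
    (h : (fun t : ℝ => polyFun q (t • v)) =O[𝓝[≠] 0] fun t => t ^ n) : polyFun q v = 0 := by
  let P : Polynomial ℝ := ∑ k ∈ Finset.range (q.totalDegree + 1),
    Polynomial.C (polyFun (homogeneousComponent k q) v) * Polynomial.X ^ k
  have hP : ∀ t, P.eval t = polyFun q (t • v) := fun t => by
    rw [polyFun_smul_eq_sum, Polynomial.eval_finsetSum]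
    simp
  have : P = 0 := by
    refine polynomial_eq_zero_of_isBigO n P ?_ (h.congr_left fun t => (hP t).symm)
    rw [Polynomial.degree_lt_iff_coeff_zero]
    intro k hk
    have : polyFun (homogeneousComponent k q) v = 0 := by rw [hq k hk]; simp [polyFun]
    simp [P, Polynomial.finsetSum_coeff, Polynomial.coeff_C_mul, Polynomial.coeff_X_pow, this]
  rw [← one_smul ℝ v, ← hP, this, Polynomial.eval_zero]

lemma isBigO_smul_line {f : Space → ℝ} {n : ℕ} (h : f =O[𝓝 0] fun y => ‖y‖ ^ n) (v : Space) :
    (fun t : ℝ => f (t • v)) =O[𝓝[≠] 0] fun t => t ^ n := by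
  have ht : Tendsto (fun t : ℝ => t • v) (𝓝[≠] 0) (𝓝 0) := by
    have : Tendsto (fun t : ℝ => t • v) (𝓝 0) (𝓝 ((0 : ℝ) • v)) :=
      (continuous_id.smul continuous_const).tendsto 0
    rw [zero_smul] at this
    exact this.mono_left nhdsWithin_le_nhds
  refine (h.comp_tendsto ht).trans (IsBigO.of_bound (‖v‖ ^ n) (Eventually.of_forall fun t => ?_))
  simp [norm_smul, mul_pow, mul_comm]

section

variable {u : Space → ℝ} {p : FormalMultilinearSeries ℝ Space ℝ}

lemma hasFPowerSeriesAt_sub_partialSumPoly (hp : HasFPowerSeriesAt u p 0) (n : ℕ) :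
    HasFPowerSeriesAt (u - polyFun (partialSumPoly p n)) (fun k => if k < n then 0 else p k) 0 := by
  let q : FormalMultilinearSeries ℝ Space ℝ := fun k => if k < n then p k else 0
  have hq : HasFPowerSeriesOnBall (polyFun (partialSumPoly p n)) q 0 ⊤ := by
    refine ⟨?_, ENNReal.zero_lt_top, fun {y} _ => ?_⟩
    · rw [FormalMultilinearSeries.radius_eq_top_of_eventually_eq_zero]
      filter_upwards [eventually_ge_atTop n] with k hk
      simp [q, not_lt.2 hk]
    · rw [zero_add, polyFun_partialSumPoly, FormalMultilinearSeries.partialSum]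
      have e : ∑ k ∈ Finset.range n, (p k fun _ => y) = ∑ k ∈ Finset.range n, q k fun _ => y :=
        Finset.sum_congr rfl fun k hk => by simp [q, Finset.mem_range.1 hk]
      rw [e]
      exact hasSum_sum_of_ne_finset_zero fun k hk => by simp [q, Finset.mem_range.not.1 hk]
  have e : (fun k => if k < n then 0 else p k) = p - q := by
    funext k
    change _ = p k - q k
    by_cases hk : k < n <;> simp [q, hk]
  rw [e]
  exact hp.sub hq.hasFPowerSeriesAt

lemma isBigO_of_forall_eq_zero {F : Type*} [NormedAddCommGroup F] [NormedSpace ℝ F]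
    {f : Space → F} {s : FormalMultilinearSeries ℝ Space F} (hf : HasFPowerSeriesAt f s 0) (n : ℕ)
    (hs : ∀ k < n, s k = 0) : f =O[𝓝 0] fun y => ‖y‖ ^ n := by
  have := hf.isBigO_sub_partialSum_pow n
  refine this.congr_left fun y => ?_
  rw [zero_add, FormalMultilinearSeries.partialSum, Finset.sum_eq_zero, sub_zero]
  intro k hk
  rw [hs k (Finset.mem_range.1 hk)]
  rfl

/-- The partial sums of the power series of a harmonic function are harmonic. -/
lemma lapl_partialSumPoly (hp : HasFPowerSeriesAt u p 0) (hu : HarmonicAt u 0) (n : ℕ) :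
    lapl (partialSumPoly p (n + 2)) = 0 := by
  set T := partialSumPoly p (n + 2)
  have hw := hasFPowerSeriesAt_sub_partialSumPoly hp (n + 2)
  obtain ⟨r, hw'⟩ := hw
  have hw1 := hw'.fderiv
  have hw2 := hw1.fderiv
  -- The remainder starts in degree n + 2, so its second derivative starts in degree n. As u is
  -- harmonic, the Laplacian of the Taylor polynomial is O(‖y‖^n) while of degree below n, hence
  -- zero.
  have hO := isBigO_of_forall_eq_zero hw2.hasFPowerSeriesAt n fun k hk => by
    refine FormalMultilinearSeries.derivSeries_eq_zero _ ?_
    refine FormalMultilinearSeries.derivSeries_eq_zero _ ?_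
    rw [if_pos (by omega)]
  have hΔ : Δ (u - polyFun T) =O[𝓝 0] fun y => ‖y‖ ^ n := by
    rw [laplacian_eq_iteratedFDeriv_orthonormalBasis _ (EuclideanSpace.basisFun (Fin 3) ℝ)]
    refine IsBigO.fun_sum fun i _ => IsBigO.trans (IsBigO.of_bound 1 ?_) hO
    refine Eventually.of_forall fun y => ?_
    rw [iteratedFDeriv_two_apply, one_mul]
    refine (ContinuousLinearMap.le_opNorm _ _).trans ?_
    refine (mul_le_mul_of_nonneg_right (ContinuousLinearMap.le_opNorm _ _) (norm_nonneg _)).trans ?_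
    simp [T]
  have hT : polyFun (lapl T) =O[𝓝 0] fun y => ‖y‖ ^ n := by
    refine hΔ.neg_left.congr' ?_ EventuallyEq.rfl
    filter_upwards [hu.2, hu.1.eventually (by simp)] with y hy hy'
    rw [hy'.laplacian_sub (contDiff_polyFun T).contDiffAt, hy, laplacian_polyFun]
    simp
  refine polyFun_injective (funext fun v => ?_)
  rw [polyFun_eq_zero_of_isBigO (n := n) ?_ (isBigO_smul_line hT v)]
  · simp [polyFun]
  · intro k hk
    have h0 : homogeneousComponent (k + 2) T = 0 := by
      rw [homogeneousComponent_partialSumPoly, if_neg (by omega)]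
    simp [lapl_apply, homogeneousComponent_pderiv, h0]

lemma polyFun_conePoly_smul (t : ℝ) (v : Space) :
    polyFun conePoly (t • v) = t ^ 2 * polyFun conePoly v := by
  simp [polyFun, conePoly]; ring

lemma polyFun_partialSumPoly_eq_zero (hp : HasFPowerSeriesAt u p 0)
    (hz : ∀ v ∈ unitBall, polyFun conePoly v = 0 → u v = 0) (n : ℕ) {v : Space}
    (hv : polyFun conePoly v = 0) : polyFun (partialSumPoly p n) v = 0 := by
  refine polyFun_eq_zero_of_isBigO (n := n) (fun k hk => ?_) ?_
  · rw [homogeneousComponent_partialSumPoly, if_neg (by omega)]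
  -- Near 0 on the line through v the function u vanishes, so the Taylor polynomial is minus the
  -- remainder, of order n.
  · have h := isBigO_smul_line (isBigO_of_forall_eq_zero
      (hasFPowerSeriesAt_sub_partialSumPoly hp n) n fun k hk => if_pos hk) v
    refine h.neg_left.congr' ?_ EventuallyEq.rfl
    have ht : Tendsto (fun t : ℝ => t • v) (𝓝[≠] 0) (𝓝 0) := by
      have : Tendsto (fun t : ℝ => t • v) (𝓝 0) (𝓝 ((0 : ℝ) • v)) :=
        (continuous_id.smul continuous_const).tendsto 0
      rw [zero_smul] at this
      exact this.mono_left nhdsWithin_le_nhds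
    filter_upwards [ht.eventually (Metric.isOpen_ball.mem_nhds (Metric.mem_ball_self one_pos))]
      with t ht
    rw [Pi.sub_apply, hz _ ht (by rw [polyFun_conePoly_smul, hv, mul_zero])]
    simp

/-- If no associated Legendre function of degree at least `L` vanishes on the cone, the harmonic
functions on the ball that vanish on the cone are polynomials. -/
theorem exists_polyFun_eq_of_vanishing (hu : HarmonicOnNhd u unitBall)
    (hz : ∀ v ∈ unitBall, polyFun conePoly v = 0 → u v = 0) (L : ℕ)
    (hL : ∀ m j, L ≤ m + j → coneValue m j ≠ 0) :
    ∃ q : MvPolynomial (Fin 3) ℝ, q.totalDegree ≤ L ∧ ∀ v ∈ unitBall, u v = polyFun q v := by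
  have h0 : (0 : Space) ∈ unitBall := Metric.mem_ball_self one_pos
  obtain ⟨p, hp⟩ := analyticAt_of_harmonicAt (hu 0 h0)
  have hterm : ∀ k ≥ L, termPoly p k = 0 := by
    intro k hk
    by_contra hne
    have e : homogeneousComponent k (partialSumPoly p (k + 2)) = termPoly p k := by
      rw [homogeneousComponent_partialSumPoly, if_pos (by omega)]
    obtain ⟨m, j, hmj, hA⟩ := exists_coneValue_eq_zero hne (termPoly_isHomogeneous p k)
      (e ▸ lapl_homogeneousComponent (lapl_partialSumPoly hp (hu 0 h0) k) k) fun v hv => by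
        rw [← e]
        exact polyFun_homogeneousComponent_eq_zero (fun t => polyFun_partialSumPoly_eq_zero hp hz _
          (by rw [polyFun_conePoly_smul, hv, mul_zero])) k
    exact hL m j (hmj ▸ hk) hA
  refine ⟨partialSumPoly p L, ?_, ?_⟩
  · refine totalDegree_finsetSum_le fun k hk => ?_
    exact (termPoly_isHomogeneous p k).totalDegree_le.trans (Finset.mem_range.1 hk).le
  -- The Taylor series converges to u only near 0; the identity theorem carries the equality to the
  -- whole ball.
  · refine AnalyticOnNhd.eqOn_of_preconnected_of_eventuallyEq (𝕜 := ℝ) (z₀ := 0)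
      (fun x hx => analyticAt_of_harmonicAt (hu x hx))
      (fun x _ => analyticOnNhd_polyFun _ x trivial) (convex_ball 0 1).isPreconnected h0 ?_
    obtain ⟨r, hr⟩ := hp
    filter_upwards [Metric.eball_mem_nhds (0 : Space) hr.r_pos] with y hy
    have hs := hr.hasSum hy
    rw [zero_add] at hs
    refine hs.unique ?_
    rw [polyFun_partialSumPoly]
    refine hasSum_sum_of_ne_finset_zero fun k hk => ?_
    rw [← polyFun_termPoly, hterm k (by simpa using hk)]
    simp [polyFun]

end

end HarmonicCone

/-! ### The two equivalences -/

namespace HarmonicCone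

open MvPolynomial InnerProductSpace Filter Asymptotics
open scoped Topology

lemma homogeneousComponent_totalDegree_ne_zero {h : MvPolynomial (Fin 3) ℝ} (h0 : h ≠ 0) :
    homogeneousComponent h.totalDegree h ≠ 0 := by
  obtain ⟨d, hd, hdeg⟩ := Finset.exists_mem_eq_sup h.support
    (Finset.nonempty_iff_ne_empty.2 fun e => h0 (support_eq_empty.1 e))
    (fun s => s.sum fun _ e => e)
  intro h1
  have h2 := congrArg (coeff d) h1
  rw [coeff_homogeneousComponent, if_pos, coeff_zero] at h2
  · exact mem_support_iff.1 hd h2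
  · exact hdeg.symm

lemma legendreTwoDvd_iff_of_le {l m : ℕ} (h : m ≤ l) :
    LegendreTwoDvd l m ↔ coneValue m (l - m) = 0 := by
  rw [← legendreTwoDvd_iff, Nat.add_sub_cancel' h]

lemma polyFun_eq_zero_of_dvd {h : MvPolynomial (Fin 3) ℝ} (hd : conePoly ∣ h) {v : Space}
    (hv : polyFun conePoly v = 0) : polyFun h v = 0 := by
  obtain ⟨q, rfl⟩ := hd
  rw [polyFun_mul, Pi.mul_apply, hv, zero_mul]

theorem exists_harmonic_multiple_iff (l : ℕ) :
    (∃ h : MvPolynomial (Fin 3) ℝ, h ≠ 0 ∧ h.totalDegree = l ∧ IsHarmonicPoly h ∧ conePoly ∣ h) ↔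
      ∃ m : ℕ, m ≤ l ∧ LegendreTwoDvd l m := by
  constructor
  · rintro ⟨h, h0, rfl, hh, hd⟩
    obtain ⟨m, j, hmj, hA⟩ := exists_coneValue_eq_zero
      (homogeneousComponent_totalDegree_ne_zero h0) (homogeneousComponent_isHomogeneous _ h)
      (lapl_homogeneousComponent ((isHarmonicPoly_iff h).1 hh) _) fun v hv =>
        polyFun_homogeneousComponent_eq_zero (fun t => polyFun_eq_zero_of_dvd hd
          (by rw [polyFun_conePoly_smul, hv, mul_zero])) _
    exact ⟨m, by omega, hmj ▸ (legendreTwoDvd_iff m j).2 hA⟩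
  · rintro ⟨m, hm, hd⟩
    refine ⟨solidHarmonic m (l - m), solidHarmonic_ne_zero _ _, ?_,
      (isHarmonicPoly_iff _).2 (lapl_solidHarmonic _ _),
      conePoly_dvd_solidHarmonic ((legendreTwoDvd_iff_of_le hm).1 hd)⟩
    rw [(solidHarmonic_isHomogeneous _ _).totalDegree (solidHarmonic_ne_zero _ _),
      Nat.add_sub_cancel' hm]

/-- The restriction of polynomials to the unit ball. -/
noncomputable def restrictBall : MvPolynomial (Fin 3) ℝ →ₗ[ℝ] (unitBall → ℝ) where
  toFun h v := polyFun h v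
  map_add' p q := by ext v; simp
  map_smul' a p := by ext v; simp [polyFun]

/-- A polynomial vanishing near 0 is O(t^n) along every line for n above its degree. -/
lemma restrictBall_injective : Function.Injective restrictBall := by
  rw [injective_iff_map_eq_zero]
  intro q hq
  refine polyFun_injective (funext fun v => ?_)
  rw [polyFun_eq_zero_of_isBigO (n := q.totalDegree + 1)
    (fun k hk => homogeneousComponent_eq_zero k q hk)]
  · simp [polyFun]
  · have ht : Tendsto (fun t : ℝ => t • v) (𝓝 0) (𝓝 ((0 : ℝ) • v)) :=
      (continuous_id.smul continuous_const).tendsto 0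
    rw [zero_smul] at ht
    have hev := (ht.mono_left (nhdsWithin_le_nhds (s := {0}ᶜ))).eventually
      (Metric.isOpen_ball.mem_nhds (Metric.mem_ball_self one_pos))
    refine (isBigO_zero _ _).congr' ?_ EventuallyEq.rfl
    filter_upwards [hev] with t ht
    exact (congrFun hq ⟨t • v, ht⟩).symm

/-- The harmonic polynomials that are divisible by the polynomial of the cone. -/
noncomputable def harmonicMultiples : Submodule ℝ (MvPolynomial (Fin 3) ℝ) :=
  LinearMap.ker lapl ⊓ (Ideal.span {conePoly}).restrictScalars ℝ

lemma solidHarmonic_mem {l m : ℕ} (hm : m ≤ l) (h : LegendreTwoDvd l m) :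
    solidHarmonic m (l - m) ∈ harmonicMultiples :=
  ⟨lapl_solidHarmonic _ _, Ideal.mem_span_singleton.2
    (conePoly_dvd_solidHarmonic ((legendreTwoDvd_iff_of_le hm).1 h))⟩

lemma restrictBall_mem {h : MvPolynomial (Fin 3) ℝ} (hh : h ∈ harmonicMultiples) :
    restrictBall h ∈ harmonicVanishing :=
  ⟨⟨polyFun h, fun _ => rfl, fun v _ => (isHarmonicPoly_iff h).2 hh.1 v trivial⟩,
    fun _ hv => polyFun_eq_zero_of_dvd (Ideal.mem_span_singleton.1 hh.2) hv⟩

lemma exists_totalDegree_le_of_fg {V : Submodule ℝ (MvPolynomial (Fin 3) ℝ)} (hV : V.FG) :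
    ∃ N, ∀ h ∈ V, h.totalDegree ≤ N := by
  obtain ⟨S, rfl⟩ := hV
  refine ⟨S.sup totalDegree, fun h hh => ?_⟩
  rw [← mem_restrictTotalDegree]
  refine (Submodule.span_le.2 fun s hs => ?_) hh
  rw [SetLike.mem_coe, mem_restrictTotalDegree]
  exact Finset.le_sup (f := totalDegree) hs

theorem finiteDimensional_harmonicVanishing_iff :
    FiniteDimensional ℝ harmonicVanishing ↔
      {q : ℕ × ℕ | q.2 ≤ q.1 ∧ LegendreTwoDvd q.1 q.2}.Finite := by
  constructor
  · intro hfin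
    have hV : FiniteDimensional ℝ harmonicMultiples :=
      Module.Finite.of_injective
        (restrictBall.restrict (p := harmonicMultiples) (q := harmonicVanishing)
          fun h hh => restrictBall_mem hh)
        fun a b hab => Subtype.ext (restrictBall_injective (congrArg Subtype.val hab))
    -- A finite-dimensional space of polynomials has bounded degree, and each pair (l, m)
    -- contributes a member of degree l.
    obtain ⟨N, hN⟩ := exists_totalDegree_le_of_fg (Module.Finite.iff_fg.1 hV)
    refine ((Set.finite_Iic N).prod (Set.finite_Iic N)).subset ?_
    rintro ⟨l, m⟩ ⟨hm, hd⟩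
    have h := hN _ (solidHarmonic_mem hm hd)
    rw [(solidHarmonic_isHomogeneous _ _).totalDegree (solidHarmonic_ne_zero _ _),
      Nat.add_sub_cancel' hm] at h
    exact ⟨h, hm.trans h⟩
  · intro hfin
    obtain ⟨L, hL⟩ := (hfin.image Prod.fst).bddAbove
    -- L bounds the degrees that do occur, so vanishing is excluded from L + 1 on.
    have hA : ∀ m j, L + 1 ≤ m + j → coneValue m j ≠ 0 := fun m j hmj h0 => by
      have := hL ⟨(m + j, m), ⟨Nat.le_add_right m j, (legendreTwoDvd_iff m j).2 h0⟩, rfl⟩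
      simp only at this
      omega
    refine Submodule.finiteDimensional_of_le
      (S₂ := (restrictTotalDegree (Fin 3) ℝ (L + 1)).map restrictBall) ?_
    rintro u ⟨⟨U, hU, hharm⟩, hz⟩
    obtain ⟨q, hq, hqU⟩ := exists_polyFun_eq_of_vanishing hharm
      (fun v hv h0 => (hU ⟨v, hv⟩).trans (hz ⟨v, hv⟩ h0)) (L + 1) hA
    refine ⟨q, (mem_restrictTotalDegree _ _ _).2 hq, funext fun v => ?_⟩
    exact ((hqU v v.2).symm.trans (hU v))

end HarmonicCone

theorem mainTheorem6 :
    (∀ l : ℕ,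
      (∃ h : MvPolynomial (Fin 3) ℝ, h ≠ 0 ∧ h.totalDegree = l ∧
          HarmonicCone.IsHarmonicPoly h ∧ HarmonicCone.conePoly ∣ h) ↔
        ∃ m : ℕ, m ≤ l ∧ HarmonicCone.LegendreTwoDvd l m) ∧
    (FiniteDimensional ℝ HarmonicCone.harmonicVanishing ↔
      {q : ℕ × ℕ | q.2 ≤ q.1 ∧ HarmonicCone.LegendreTwoDvd q.1 q.2}.Finite) :=
  ⟨HarmonicCone.exists_harmonic_multiple_iff,
    HarmonicCone.finiteDimensional_harmonicVanishing_iff⟩
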